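/- **Setting.** Let $\mathcal S^\downarrow=\{\mathbf s=(s_1\ge s_2\ge\cdots\ge 0):\sum_i s_i\le 1\}$. Let $X$ be a fragmentation chain with self-similarity parameter $\alpha\ge 0$ and dislocation measure $\nu$, a probability measure on $\mathcal S^\downarrow$, started from a single fragment of size $1$: a fragment of size $x$ lives for an exponential time of parameter $x^\alpha$ and then splits into fragments of sizes $x\xi$, where $\xi\sim\nu$, independently of everything else. Let $\mathcal U=\bigcup_{n\ge 0}\mathbb N^n$ be its genealogical tree, $\xi_u$ the size of the fragment labelled by $u\in\mathcal U$, and $u-$ the parent of $u$. Let $(U_u)_{u\in\mathcal U}$ be identically distributed random variables (with a given joint law, not necessarily independent of each other), independent of $X$, with $|U_u|\le 1$ and $\mathbb E[U_u]=0$. Let $\sigma=\sigma(\varepsilon)\ge 0$ be a known noise level such that $\sigma\varepsilon^{-3}$ remains bounded as $\varepsilon\to 0$. At stage $\varepsilon>0$ one observes $$X_{\varepsilon,\sigma}=\big(\xi_u^{(\sigma)},\ u\in\mathcal U_{\varepsilon,\sigma}\big),\qquad \xi_u^{(\sigma)}=\xi_u+\sigma U_u,\qquad \mathcal U_{\varepsilon,\sigma}=\{u:\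 \xi_{u-}^{(\sigma)}\ge\varepsilon,\ \xi_u^{(\sigma)}<\varepsilon\}.$$ Let $\pi(dx)=e^{-x}\sum_{i\ge1}\nu(-\log s_i\in dx)$ on $[0,\infty)$ be the Lévy measure of the randomly tagged fragment, and for real $k\ge 1$ let $m_k(\pi)=\int_0^\infty x^k\,\pi(dx)$. Fix $0<\kappa_1,\kappa_2\le\infty$ with $\kappa_1>\max\{1,\kappa_2\}$. Say that $\nu$ (or $\pi$) belongs to the model if: * $\nu(\{(1,0,\dots)\})=0$, $\nu(s_1\in(0,1))>0$, and $\int\sum_i 1_{\{s_i>\eta\}}\,d\nu<\infty$ for every $\eta>0$; * $\nu(\sum_i s_i=1)=1$ (mass is conserved); * $\pi$ is absolutely continuous; * $\pi\in\Pi(\kappa_1)$: $\pi$ is spread-out (some convolution power $\pi^{*n}$, $n\ge1$, has a nonzero absolutely continuous component) and $\int e^{\kappa_1x}\pi(dx)<\infty$, with $\Pi(\infty)=\bigcap_{\kappa>0}\Pi(\kappa)$; * $\pi\in\mathcal R(\kappa_2)$: $\pi$ has a density $\pi(x)$ with $\limsup_{x\to0}x^{-\kappa_2+1}\pi(x)<\infty$,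 with $\mathcal R(\infty)=\bigcap_{\kappa>0}\mathcal R(\kappa)$. The fragmentation is *binary* if $\nu(s_1+s_2\ne1)=0$; then $\rho$ denotes the law of $s_1$ under $\nu$, a probability measure on $[1/2,1]$. **Theorem.** Let $\pi_0$ belong to the model. Assume that the fragmentation is binary and that its splitting law $\rho$ is absolutely continuous with a density bounded away from zero on $[1/2,1]$. Then $v_\varepsilon=\varepsilon^{1/2}$ is a lower rate of convergence for estimating $m_k(\pi_0)$: there exist a family $(\pi_\varepsilon)_{\varepsilon>0}$ in the model (with the same $\kappa_1,\kappa_2$), also binary with splitting densities bounded away from zero, and a constant $c>0$ such that $$\liminf_{\varepsilon\to0}\ \inf_{F_\varepsilon}\ \max_{\pi\in\{\pi_0,\pi_\varepsilon\}}\mathbb P_\pi\big[\varepsilon^{-1/2}\,|F_\varepsilon-m_k(\pi)|\ge c\big]>0,$$ where, for every $\varepsilon$, the infimum is over all estimators (measurable real functions) of the data $X_{\varepsilon,\sigma}$. -/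

import Mathlib

open MeasureTheory ProbabilityTheory Filter Topology Set
open scoped ENNReal

noncomputable section

namespace Fragmentation

/-! ### Mass partitions and the genealogical tree -/

/-- The space of mass partitions: nonincreasing sequences of nonnegative reals with sum at
most one, with the trace of the product sigma-algebra. The entry `s.1 0` is the largest part. -/
abbrev MassPartition : Type :=
  {s : ℕ → ℝ // Antitone s ∧ (∀ i, 0 ≤ s i) ∧ Summable s ∧ ∑' i, s i ≤ 1}

/-- The nodes of the infinite genealogical tree. The root is `[]`, and `i :: w` is the `i`-th
child of `w`, so that `w` is the parent of `i :: w`. -/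
abbrev Node : Type := List ℕ

/-- The randomness that drives a fragmentation chain: each node carries the relative sizes of
its children and a standard exponential clock. -/
abbrev Environment : Type := Node → MassPartition × ℝ

/-- The size of the fragment labelled by a node; the initial fragment has size one. -/
def size (ω : Environment) : Node → ℝ
  | [] => 1
  | i :: w => size ω w * (ω w).1.1 i

/-- The lifetime of a fragment of size `x` is exponential with parameter `x ^ α`. -/
def lifetime (α : ℝ) (ω : Environment) (u : Node) : ℝ :=
  (ω u).2 / size ω u ^ α

/-- The birth time of the fragment labelled by a node. -/
def birth (α : ℝ) (ω : Environment) : Node → ℝ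
  | [] => 0
  | _ :: w => birth α ω w + lifetime α ω w

/-- The fragmentation chain with self-similarity parameter `α` as a marked tree:
size, birth time and lifetime of each fragment. -/
def chain (α : ℝ) (ω : Environment) (u : Node) : ℝ × ℝ × ℝ :=
  (size ω u, birth α ω u, lifetime α ω u)

/-- The law of the environment for the dislocation measure `ν`: the children of distinct
fragments are split independently according to `ν`, and the clocks are independent. -/
def envLaw (ν : ProbabilityMeasure MassPartition) : Measure Environment :=
  Measure.infinitePi fun _ : Node => (ν : Measure MassPartition).prod (expMeasure 1)

/-! ### The observations -/

/-- The noise variables are identically distributed, bounded by one and centred. They need not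
be independent of each other. -/
structure IsNoise (Q : ProbabilityMeasure (Node → ℝ)) : Prop where
  identDistrib : ∀ u v : Node,
    (Q : Measure (Node → ℝ)).map (fun U => U u) = (Q : Measure (Node → ℝ)).map (fun U => U v)
  bounded : ∀ u : Node, ∀ᵐ U ∂(Q : Measure (Node → ℝ)), |U u| ≤ 1
  centred : ∀ u : Node, ∫ U, U u ∂(Q : Measure (Node → ℝ)) = 0

/-- The joint law of the fragmentation started from one fragment of size one and of the noise,
which is independent of the fragmentation. -/
def law (Q : ProbabilityMeasure (Node → ℝ)) (ν : ProbabilityMeasure MassPartition) :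
    Measure (Environment × (Node → ℝ)) :=
  (envLaw ν).prod (Q : Measure (Node → ℝ))

/-- The size of a fragment measured at noise level `σ`. -/
def noisySize (α σ : ℝ) (x : Environment × (Node → ℝ)) (u : Node) : ℝ :=
  (chain α x.1 u).1 + σ * x.2 u

/-- The nodes of the fragments that are measured below `ε` whereas their parent is not. -/
def observedNodes (α σ ε : ℝ) (x : Environment × (Node → ℝ)) : Set Node :=
  {u | ∃ (i : ℕ) (w : Node), u = i :: w ∧ ε ≤ noisySize α σ x w ∧ noisySize α σ x u < ε}

open Classical in
/-- The data at stage `ε`: the family of the measured sizes, indexed by the observed nodes. A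
node that is not observed is sent to `(false, 0)`. -/
def observation (α σ ε : ℝ) (x : Environment × (Node → ℝ)) (u : Node) : Bool × ℝ :=
  if u ∈ observedNodes α σ ε x then (true, noisySize α σ x u) else (false, 0)

/-! ### The Lévy measure of the tagged fragment and its moments -/

/-- The Lévy measure `π(dx) = e ^ (-x) ∑ᵢ ν(-log sᵢ ∈ dx)` on `[0, ∞)` of the randomly tagged
fragment. Parts of size zero are sent to infinity and do not contribute. -/
def levyMeasure (ν : ProbabilityMeasure MassPartition) : Measure ℝ :=
  (Measure.sum fun i : ℕ =>
      ((ν : Measure MassPartition).restrict {s | 0 < s.1 i}).map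
        fun s => -Real.log (s.1 i)).withDensity
    fun x => ENNReal.ofReal (Real.exp (-x))

/-- The moment of order `k` of a measure on the half-line. -/
def moment (k : ℝ) (π : Measure ℝ) : ℝ := ∫ x in Ioi (0 : ℝ), x ^ k ∂π

/-- Convolution powers of a measure on the line. -/
def convPow (π : Measure ℝ) : ℕ → Measure ℝ
  | 0 => Measure.dirac 0
  | n + 1 => Measure.conv (convPow π n) π

/-- Some convolution power has a nonzero absolutely continuous component. -/
def SpreadOut (π : Measure ℝ) : Prop :=
  ∃ n : ℕ, 1 ≤ n ∧ (volume : Measure ℝ).withDensity ((convPow π n).rnDeriv volume) ≠ 0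

/-- The class `Π(κ)` for a finite exponent. -/
def ExpMomentReal (κ : ℝ) (π : Measure ℝ) : Prop :=
  SpreadOut π ∧ ∫⁻ x in Ici (0 : ℝ), ENNReal.ofReal (Real.exp (κ * x)) ∂π < ∞

/-- The class `Π(κ)`, where `Π(∞)` is the intersection of the classes `Π(r)` for `r > 0`. -/
def ExpMoment (κ : ℝ≥0∞) (π : Measure ℝ) : Prop :=
  (κ ≠ ∞ → ExpMomentReal κ.toReal π) ∧ (κ = ∞ → ∀ r : ℝ, 0 < r → ExpMomentReal r π)

/-- The class `R(κ)` for a finite exponent: `π` has a density `p` for which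
`x ^ (1 - κ) * p x` has a finite upper limit at `0`. -/
def DecayReal (κ : ℝ) (π : Measure ℝ) : Prop :=
  ∃ p : ℝ → ℝ≥0∞, Measurable p ∧ π = (volume : Measure ℝ).withDensity p ∧
    limsup (fun x : ℝ => ENNReal.ofReal (x ^ (-κ + 1)) * p x) (𝓝[>] 0) < ∞

/-- The class `R(κ)`, where `R(∞)` is the intersection of the classes `R(r)` for `r > 0`. -/
def Decay (κ : ℝ≥0∞) (π : Measure ℝ) : Prop :=
  (κ ≠ ∞ → DecayReal κ.toReal π) ∧ (κ = ∞ → ∀ r : ℝ, 0 < r → DecayReal r π)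

/-! ### The assumptions -/

/-- The standing assumptions on a dislocation measure: it does not charge the trivial partition
`(1, 0, …)`, it charges `s₁ ∈ (0, 1)`, and the expected number of parts above any positive level
is finite. -/
structure Regular (ν : ProbabilityMeasure MassPartition) : Prop where
  no_trivial : (ν : Measure MassPartition) {s | ∀ i, s.1 i = if i = 0 then 1 else 0} = 0
  nontrivial : 0 < (ν : Measure MassPartition) {s | s.1 0 ∈ Ioo (0 : ℝ) 1}
  finite_parts : ∀ ε : ℝ, 0 < ε →
    ∫⁻ s, ∑' i : ℕ, {s : MassPartition | ε < s.1 i}.indicator (fun _ => (1 : ℝ≥0∞)) s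
      ∂(ν : Measure MassPartition) < ∞

/-- Mass is conserved at each dislocation. -/
def Conservative (ν : ProbabilityMeasure MassPartition) : Prop :=
  ∀ᵐ s ∂(ν : Measure MassPartition), ∑' i, s.1 i = 1

/-- The model with exponents `κ₁` and `κ₂`: a regular conservative dislocation measure whose Lévy
measure is absolutely continuous and belongs to `Π(κ₁) ∩ R(κ₂)`. -/
structure Model (κ₁ κ₂ : ℝ≥0∞) (ν : ProbabilityMeasure MassPartition) : Prop where
  regular : Regular ν
  conservative : Conservative ν
  absolutelyContinuous : levyMeasure ν ≪ volume
  expMoment : ExpMoment κ₁ (levyMeasure ν)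
  decay : Decay κ₂ (levyMeasure ν)

/-- Each fragment splits into exactly two pieces. -/
def Binary (ν : ProbabilityMeasure MassPartition) : Prop :=
  ∀ᵐ s ∂(ν : Measure MassPartition), s.1 0 + s.1 1 = 1

/-- The law `ρ` of the relative size of the larger piece. -/
def splitLaw (ν : ProbabilityMeasure MassPartition) : Measure ℝ :=
  (ν : Measure MassPartition).map fun s => s.1 0

/-- The splitting law is absolutely continuous and its density on `[1/2, 1]` is bounded away
from zero. -/
def SplitDensityBoundedBelow (ν : ProbabilityMeasure MassPartition) : Prop :=
  splitLaw ν ≪ volume ∧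
    ∃ δ : ℝ, 0 < δ ∧ ∀ᵐ a ∂(volume.restrict (Icc (1 / 2 : ℝ) 1)),
      ENNReal.ofReal δ ≤ (splitLaw ν).rnDeriv volume a

/-! ### Lower rates of convergence -/

/-- The probability under `ν` that the estimator `F` of the moment of order `k` makes an error of
at least `c` times the rate `r`. -/
def errorProb (α k σ ε : ℝ) (Q : ProbabilityMeasure (Node → ℝ)) (r c : ℝ)
    (F : (Node → Bool × ℝ) → ℝ) (ν : ProbabilityMeasure MassPartition) : ℝ≥0∞ :=
  law Q ν {x | c ≤ r⁻¹ * |F (observation α σ ε x) - moment k (levyMeasure ν)|}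

/-- The rate `v` is a lower rate of convergence at `ν₀` for estimating the moment of order `k`
within the class `M` of dislocation measures: there are alternatives `ν' ε` in `M` such that no
estimator based on the data at stage `ε` estimates this moment at a faster rate under both `ν₀`
and `ν' ε`. -/
def IsLowerRate (M : Set (ProbabilityMeasure MassPartition)) (α k : ℝ) (σ : ℝ → ℝ)
    (Q : ProbabilityMeasure (Node → ℝ)) (ν₀ : ProbabilityMeasure MassPartition)
    (v : ℝ → ℝ) : Prop :=
  (∀ ε : ℝ, 0 < ε → 0 < v ε) ∧ Tendsto v (𝓝[>] 0) (𝓝 0) ∧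
    ∃ ν' : ℝ → ProbabilityMeasure MassPartition, (∀ ε : ℝ, 0 < ε → ν' ε ∈ M) ∧
      ∃ c : ℝ, 0 < c ∧
        0 < liminf
          (fun ε : ℝ =>
            ⨅ (F : (Node → Bool × ℝ) → ℝ) (_ : Measurable F),
              max (errorProb α k (σ ε) ε Q (v ε) c F ν₀)
                (errorProb α k (σ ε) ε Q (v ε) c F (ν' ε)))
          (𝓝[>] 0)

end Fragmentation

end

/-! The bound is a two-point testing argument. Tilt `ν₀` by a density `1 + η h`, where `|h| ≤ 1`,
`h` is centred under `ν₀` and `η = √ε` for small `ε`. The moment is linear in the dislocation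
measure, so it moves by exactly `η` times the covariance of `h` with the mass moment
(`moment_withDensity`). This covariance can be made positive because the mass moment of `(a, 1 - a)`
is not constant: it is `(log 2) ^ k` at `a = 1/2` and tends to `0` as `a → 1`
(`exists_massMoment_threshold`, `exists_correlated_direction`).

It remains to see that the data cannot detect the tilt. Since the noise is eventually at most `ε /
2`, the data given the noise depend only on the dislocations of fragments of size at least `ε / 2`
(`stopped_observation`). The expected number of such fragments is `O(1 / ε)`
(`mul_tsum_measure_size_le`), and each adds at most `2 η²` to the relative entropy of the two laws.
The total entropy is thus bounded, and the errors of any test sum to at least a positive constant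
(`sum_errors_ge`).

The likelihood ratio is a product over infinitely many nodes. It is handled by stopping the weights
below the size level and keeping a finite set of labels that captures all large fragments up to a
small probability. The alternatives stay in the model because their densities lie between `1/2` and
`3/2` (`Model.of_le`). -/

noncomputable section

namespace Fragmentation

/-! ### Resampling and reweighting coordinates of infinite product measures. -/

section InfiniteProducts

variable {ι X : Type*} [MeasurableSpace X]

/-- Resampling one coordinate preserves an infinite product measure. -/
theorem map_update_infinitePi [DecidableEq ι] (μ : ι → Measure X)
    [∀ i, IsProbabilityMeasure (μ i)] (i : ι) :
    ((Measure.infinitePi μ).prod (μ i)).map (fun p => Function.update p.1 i p.2) =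
      Measure.infinitePi μ := by
  have hm : Measurable (fun p : (ι → X) × X => Function.update p.1 i p.2) := by fun_prop
  refine Measure.eq_infinitePi _ fun s t ht => ?_
  rw [Measure.map_apply hm (MeasurableSet.pi s.countable_toSet fun j _ => ht j)]
  by_cases hi : i ∈ s
  · have : (fun p : (ι → X) × X => Function.update p.1 i p.2) ⁻¹' ((s : Set ι).pi t) =
        (((s.erase i : Finset ι) : Set ι).pi t) ×ˢ t i := by
      ext p
      simp only [mem_preimage, Set.mem_pi, Set.mem_prod, Finset.mem_coe, Finset.mem_erase]
      constructor
      · intro h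
        refine ⟨fun j hj => by simpa [hj.1] using h j hj.2, by simpa using h i hi⟩
      · rintro ⟨h1, h2⟩ j hj
        by_cases hji : j = i
        · subst hji; simpa using h2
        · simpa [hji] using h1 j ⟨hji, hj⟩
    rw [this, Measure.prod_prod, Measure.infinitePi_pi _ (fun j _ => ht j),
      Finset.prod_erase_mul _ _ hi]
  · have : (fun p : (ι → X) × X => Function.update p.1 i p.2) ⁻¹' ((s : Set ι).pi t) =
        ((s : Set ι).pi t) ×ˢ univ := by
      ext p
      simp only [mem_preimage, Set.mem_pi, Set.mem_prod, Finset.mem_coe, mem_univ, and_true]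
      refine forall₂_congr fun j hj => ?_
      have hji : j ≠ i := fun h => hi (h ▸ hj)
      simp [hji]
    rw [this, Measure.prod_prod, Measure.infinitePi_pi _ (fun j _ => ht j), measure_univ,
      mul_one]

theorem lintegral_update_infinitePi [DecidableEq ι] (μ : ι → Measure X)
    [∀ i, IsProbabilityMeasure (μ i)] (i : ι) {f : (ι → X) → ℝ≥0∞} (hf : Measurable f) :
    ∫⁻ ω, f ω ∂(Measure.infinitePi μ) =
      ∫⁻ ω, ∫⁻ x, f (Function.update ω i x) ∂(μ i) ∂(Measure.infinitePi μ) := by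
  conv_lhs => rw [← map_update_infinitePi μ i]
  rw [lintegral_map hf (by fun_prop), lintegral_prod _ (by fun_prop)]

theorem integral_update_infinitePi [DecidableEq ι] (μ : ι → Measure X)
    [∀ i, IsProbabilityMeasure (μ i)] (i : ι) {f : (ι → X) → ℝ}
    (hf : Integrable f (Measure.infinitePi μ)) :
    ∫ ω, f ω ∂(Measure.infinitePi μ) =
      ∫ ω, ∫ x, f (Function.update ω i x) ∂(μ i) ∂(Measure.infinitePi μ) := by
  have hm : Measurable (fun p : (ι → X) × X => Function.update p.1 i p.2) := by fun_prop
  rw [← map_update_infinitePi μ i] at hf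
  conv_lhs => rw [← map_update_infinitePi μ i]
  rw [integral_map hm.aemeasurable hf.1]
  exact integral_prod _ ((integrable_map_measure hf.1 hm.aemeasurable).1 hf)

/-- Weighting finitely many coordinates of an infinite product measure. -/
theorem infinitePi_withDensity_prod [DecidableEq ι] (μ μ' : Measure X)
    [IsProbabilityMeasure μ] [IsProbabilityMeasure μ'] {g : X → ℝ≥0∞} (hg : Measurable g)
    (h : μ' = μ.withDensity g) (T : Finset ι) :
    (Measure.infinitePi fun _ : ι => μ).withDensity (fun ω => ∏ v ∈ T, g (ω v)) =
      Measure.infinitePi fun v : ι => if v ∈ T then μ' else μ := by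
  have : ∀ v : ι, IsProbabilityMeasure (if v ∈ T then μ' else μ) := fun v => by
    split_ifs <;> infer_instance
  refine Measure.eq_infinitePi _ fun s t ht => ?_
  have hpi := MeasurableSet.pi s.countable_toSet fun j _ => ht j
  rw [withDensity_apply _ hpi, ← lintegral_indicator hpi]
  -- Weight and cylinder indicator are merged into one function per coordinate, so that independence
  -- factorizes the integral over `s ∪ T`.
  let f : ι → X → ℝ≥0∞ := fun v x =>
    (if v ∈ T then g x else 1) * (if v ∈ s then (t v).indicator 1 x else 1)
  have hf : ∀ v, Measurable (f v) := by
    intro v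
    refine Measurable.mul ?_ ?_
    · split_ifs <;> fun_prop
    · split_ifs
      · exact measurable_one.indicator (ht v)
      · fun_prop
  have e1 : ∀ ω : ι → X, ((s : Set ι).pi t).indicator (fun ω => ∏ v ∈ T, g (ω v)) ω =
      ∏ v ∈ s ∪ T, f v (ω v) := by
    intro ω
    simp only [f, Finset.prod_mul_distrib]
    have a1 : ∏ v ∈ s ∪ T, (if v ∈ T then g (ω v) else 1) = ∏ v ∈ T, g (ω v) := by
      rw [← Finset.prod_filter]
      congr 1; ext v; simp
    have a2 : ∏ v ∈ s ∪ T, (if v ∈ s then (t v).indicator (1 : X → ℝ≥0∞) (ω v) else 1) =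
        ∏ v ∈ s, (t v).indicator (1 : X → ℝ≥0∞) (ω v) := by
      rw [← Finset.prod_filter]
      congr 1; ext v; simp
    rw [a1, a2]
    by_cases hω : ω ∈ (s : Set ι).pi t
    · rw [indicator_of_mem hω, Finset.prod_eq_one (s := s), mul_one]
      intro v hv
      rw [indicator_of_mem (hω v hv)]; rfl
    · rw [indicator_of_notMem hω]
      simp only [Set.mem_pi, not_forall] at hω
      obtain ⟨v, hv, hvt⟩ := hω
      rw [Finset.prod_eq_zero (i := v) (s := s) hv (indicator_of_notMem hvt _), mul_zero]
  simp_rw [e1]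
  have hind : iIndepFun (fun (v : ι) (ω : ι → X) => f v (ω v))
      (Measure.infinitePi fun _ : ι => μ) :=
    iIndepFun_infinitePi (P := fun _ : ι => μ) (X := f) (fun v => hf v)
  refine (lintegral_prod_eq_prod_lintegral_of_indepFun (s ∪ T)
    (fun v (ω : ι → X) => f v (ω v)) hind
    (fun v => (hf v).comp (measurable_pi_apply v))).trans ?_
  have e2 : ∀ v, ∫⁻ ω : ι → X, f v (ω v) ∂(Measure.infinitePi fun _ : ι => μ) =
      if v ∈ s then (if v ∈ T then μ' else μ) (t v) else 1 := by
    intro v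
    have := lintegral_map (μ := Measure.infinitePi fun _ : ι => μ) (hf v) (measurable_pi_apply v)
    rw [← this, Measure.infinitePi_map_eval]
    simp only [f]
    have hg1 : ∫⁻ x, g x ∂μ = 1 := by
      rw [← setLIntegral_univ, ← withDensity_apply _ MeasurableSet.univ, ← h, measure_univ]
    split_ifs with h1 h2 h2
    · rw [h, withDensity_apply _ (ht v), ← lintegral_indicator (ht v)]
      congr 1; ext x; by_cases hx : x ∈ t v <;> simp [hx]
    · simpa using hg1
    · simp [lintegral_indicator_one (ht v)]
    · simp
  simp_rw [e2]
  rw [← Finset.prod_filter]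
  congr 1; ext v; simp

/-- Infinite product measures that agree on finitely many coordinates give the same mass to
the events that depend only on these coordinates. -/
theorem infinitePi_apply_congr [Nonempty X] [DecidableEq ι] (μ μ' : ι → Measure X)
    [∀ i, IsProbabilityMeasure (μ i)] [∀ i, IsProbabilityMeasure (μ' i)] (T : Finset ι)
    (h : ∀ i ∈ T, μ i = μ' i) {D : Set (ι → X)} (hD : MeasurableSet D)
    (hT : ∀ ω ω' : ι → X, (∀ i ∈ T, ω i = ω' i) → ω ∈ D → ω' ∈ D) :
    Measure.infinitePi μ D = Measure.infinitePi μ' D := by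
  obtain ⟨x₀⟩ := ‹Nonempty X›
  -- Configurations on `T` are extended by a constant; as `D` sees only `T`, it is the preimage of a
  -- set of finite configurations.
  let e : (T → X) → ι → X := fun y i => if hi : i ∈ T then y ⟨i, hi⟩ else x₀
  have he : Measurable e := by
    refine measurable_pi_lambda _ fun i => ?_
    by_cases hi : i ∈ T
    · simp only [e, hi, dite_true]; exact measurable_pi_apply _
    · simp only [e, hi, dite_false]; exact measurable_const
  have hpre : D = T.restrict ⁻¹' (e ⁻¹' D) := by
    ext ω
    have : ∀ i ∈ T, ω i = e (T.restrict ω) i := fun i hi => by simp [e, hi]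
    exact ⟨fun hω => hT _ _ this hω, fun hω => hT _ _ (fun i hi => (this i hi).symm) hω⟩
  have hpi : Measure.pi (fun i : T => μ i) = Measure.pi fun i : T => μ' i := by
    congr 1; ext1 i; exact h i i.2
  rw [hpre, ← Measure.map_apply (by fun_prop) (he hD), ← Measure.map_apply (by fun_prop) (he hD),
    Measure.infinitePi_map_restrict, Measure.infinitePi_map_restrict, hpi]

/-- Change of measure on events that depend on finitely many coordinates. -/
theorem infinitePi_apply_eq_lintegral [Nonempty X] [DecidableEq ι] (μ μ' : Measure X)
    [IsProbabilityMeasure μ] [IsProbabilityMeasure μ'] {g : X → ℝ≥0∞} (hg : Measurable g)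
    (h : μ' = μ.withDensity g) (T : Finset ι) {D : Set (ι → X)} (hD : MeasurableSet D)
    (hT : ∀ ω ω' : ι → X, (∀ i ∈ T, ω i = ω' i) → ω ∈ D → ω' ∈ D) :
    Measure.infinitePi (fun _ : ι => μ') D =
      ∫⁻ ω, (∏ v ∈ T, g (ω v)) * D.indicator 1 ω ∂(Measure.infinitePi fun _ : ι => μ) := by
  have : ∀ v : ι, IsProbabilityMeasure (if v ∈ T then μ' else μ) := fun v => by
    split_ifs <;> infer_instance
  -- Off `T` the factors may be reset to `μ`, which leaves a finite product of densities.
  rw [infinitePi_apply_congr (fun _ => μ') (fun v => if v ∈ T then μ' else μ) T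
    (fun i hi => by simp [hi]) hD hT, ← infinitePi_withDensity_prod μ μ' hg h T,
    withDensity_apply _ hD, ← lintegral_indicator hD]
  congr 1; ext ω; by_cases hω : ω ∈ D <;> simp [hω]

end InfiniteProducts

/-! ### Fragment sizes -/

theorem MassPartition.nonneg (s : MassPartition) (i : ℕ) : 0 ≤ s.1 i := s.2.2.1 i

theorem MassPartition.le_one (s : MassPartition) (i : ℕ) : s.1 i ≤ 1 :=
  (s.2.2.2.1.le_tsum i fun j _ => s.2.2.1 j).trans s.2.2.2.2

theorem MassPartition.measurable_part (i : ℕ) : Measurable fun s : MassPartition => s.1 i :=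
  (measurable_pi_apply i).comp measurable_subtype_coe

instance : Nonempty MassPartition :=
  ⟨⟨fun _ => 0, fun _ _ _ => le_rfl, fun _ => le_rfl, summable_zero, by simp⟩⟩

theorem size_nonneg (ω : Environment) : ∀ u, 0 ≤ size ω u
  | [] => zero_le_one
  | i :: w => mul_nonneg (size_nonneg ω w) ((ω w).1.nonneg i)

theorem size_cons_le (ω : Environment) (i : ℕ) (w : Node) : size ω (i :: w) ≤ size ω w :=
  mul_le_of_le_one_right (size_nonneg ω w) ((ω w).1.le_one i)

theorem measurable_size : ∀ u : Node, Measurable fun ω : Environment => size ω u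
  | [] => measurable_const
  | i :: w => (measurable_size w).mul
      ((MassPartition.measurable_part i).comp (measurable_fst.comp (measurable_pi_apply w)))

/-- The size of a fragment does not depend on how a fragment of the same or of a later
generation splits. -/
theorem size_update_of_length_le (ω : Environment) (w : Node) (y : MassPartition × ℝ) :
    ∀ u : Node, u.length ≤ w.length → size (Function.update ω w y) u = size ω u
  | [], _ => rfl
  | i :: v, h => by
    have hv : v.length < w.length := by simpa using h
    have hne : v ≠ w := fun h => by simp [h] at hv
    simp only [size]
    rw [size_update_of_length_le ω w y v hv.le, Function.update_of_ne hne]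

theorem size_update_self (ω : Environment) (w : Node) (y : MassPartition × ℝ) :
    size (Function.update ω w y) w = size ω w :=
  size_update_of_length_le ω w y w le_rfl

/-! ### Functions that see only the large fragments. -/

/-- Two environments that agree at all fragments of size at least `x`. -/
def AgreeAbove (x : ℝ) (ω ω' : Environment) : Prop := ∀ w, x ≤ size ω w → ω w = ω' w

/-- Every ancestor of a large fragment is large, so the agreement propagates from the root. -/
theorem AgreeAbove.size_eq {x : ℝ} {ω ω' : Environment} (h : AgreeAbove x ω ω') :
    ∀ u, x ≤ size ω u → size ω' u = size ω u
  | [], _ => rfl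
  | i :: w, hu => by
    have hw := hu.trans (size_cons_le ω i w)
    simp only [size]
    rw [h.size_eq w hw, h w hw]

/-- `AgreeAbove` measures sizes in its first environment only; this converse is what makes it
symmetric. -/
theorem AgreeAbove.size_eq' {x : ℝ} {ω ω' : Environment} (h : AgreeAbove x ω ω') :
    ∀ u, x ≤ size ω' u → size ω u = size ω' u
  | [], _ => rfl
  | i :: w, hu => by
    have hw := h.size_eq' w (hu.trans (size_cons_le ω' i w))
    have hw' : x ≤ size ω w := hw ▸ hu.trans (size_cons_le ω' i w)
    simp only [size]
    rw [hw, h w hw']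

theorem AgreeAbove.le_size_iff {x : ℝ} {ω ω' : Environment} (h : AgreeAbove x ω ω') (u : Node) :
    x ≤ size ω u ↔ x ≤ size ω' u :=
  ⟨fun hu => (h.size_eq u hu).symm ▸ hu, fun hu => (h.size_eq' u hu).symm ▸ hu⟩

theorem AgreeAbove.symm {x : ℝ} {ω ω' : Environment} (h : AgreeAbove x ω ω') :
    AgreeAbove x ω' ω := fun w hw => (h w ((h.le_size_iff w).2 hw)).symm

theorem agreeAbove_update {x : ℝ} {ω : Environment} {w : Node} (h : size ω w < x)
    (y : MassPartition × ℝ) : AgreeAbove x ω (Function.update ω w y) := fun v hv => by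
  rw [Function.update_of_ne]
  rintro rfl
  exact absurd hv (not_le.2 h)

/-- A function of the environment that only depends on the dislocations of the fragments of size
at least `x`. -/
def Stopped {β : Type*} (x : ℝ) (f : Environment → β) : Prop :=
  ∀ ω ω', AgreeAbove x ω ω' → f ω = f ω'

/-- The contribution of the node `w` to the likelihood ratio: only the dislocations of the
fragments of size at least `x` are recorded. -/
def stoppedWeight {β : Type*} [One β] (x : ℝ) (g : MassPartition → β) (w : Node)
    (ω : Environment) : β :=
  open Classical in if x ≤ size ω w then g (ω w).1 else 1

theorem stopped_stoppedWeight {β : Type*} [One β] (x : ℝ) (g : MassPartition → β) (w : Node) :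
    Stopped x (stoppedWeight x g w) := by
  intro ω ω' h
  unfold stoppedWeight
  by_cases hw : x ≤ size ω w
  · rw [if_pos hw, if_pos ((h.le_size_iff w).1 hw), h w hw]
  · rw [if_neg hw, if_neg (mt (h.le_size_iff w).2 hw)]

theorem measurable_stoppedWeight {β : Type*} [One β] [MeasurableSpace β] (x : ℝ)
    {g : MassPartition → β} (hg : Measurable g) (w : Node) :
    Measurable (stoppedWeight x g w) := by
  unfold stoppedWeight
  exact Measurable.ite (measurableSet_le measurable_const (measurable_size w))
    (hg.comp (measurable_fst.comp (measurable_pi_apply w))) measurable_const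

instance : IsProbabilityMeasure (expMeasure 1) := isProbabilityMeasure_expMeasure one_pos

instance (ν : ProbabilityMeasure MassPartition) : IsProbabilityMeasure (envLaw ν) := by
  unfold envLaw; infer_instance

/-! ### Change of measure for the stopped tree. -/

theorem lintegral_update_envLaw (ν : ProbabilityMeasure MassPartition) (w : Node)
    {f : Environment → ℝ≥0∞} (hf : Measurable f) :
    ∫⁻ ω, f ω ∂envLaw ν =
      ∫⁻ ω, ∫⁻ y, f (Function.update ω w y) ∂((ν : Measure MassPartition).prod (expMeasure 1))
        ∂envLaw ν := by
  exact lintegral_update_infinitePi (fun _ => (ν : Measure MassPartition).prod (expMeasure 1)) w hf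

theorem lintegral_fst_prod_expMeasure (ν : ProbabilityMeasure MassPartition)
    {g : MassPartition → ℝ≥0∞} (hg : Measurable g) :
    ∫⁻ y, g y.1 ∂((ν : Measure MassPartition).prod (expMeasure 1)) =
      ∫⁻ s, g s ∂(ν : Measure MassPartition) := by
  rw [← lintegral_map hg measurable_fst, Measure.map_fst_prod]; simp

/-- In an expectation of a stopped function, a weight at one node can be replaced by its stopped
version. -/
theorem lintegral_weight_mul_eq (ν : ProbabilityMeasure MassPartition)
    {g : MassPartition → ℝ≥0∞} (hg : Measurable g)
    (hg1 : ∫⁻ s, g s ∂(ν : Measure MassPartition) = 1) (x : ℝ) (w : Node) (S : Finset Node)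
    (hw : w ∉ S) {f : Environment → ℝ≥0∞} (hf : Measurable f) (hfs : Stopped x f) :
    ∫⁻ ω, g (ω w).1 * (∏ v ∈ S, g (ω v).1) * f ω ∂envLaw ν =
      ∫⁻ ω, (∏ v ∈ S, g (ω v).1) * (stoppedWeight x g w ω * f ω) ∂envLaw ν := by
  have hgm : ∀ v : Node, Measurable fun ω : Environment => g (ω v).1 := fun v =>
    hg.comp (measurable_fst.comp (measurable_pi_apply v))
  have hP : Measurable fun ω : Environment => ∏ v ∈ S, g (ω v).1 :=
    Finset.measurable_fun_prod _ fun v _ => hgm v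
  have hs := measurable_stoppedWeight x hg w
  rw [lintegral_update_envLaw ν w (f := fun ω => g (ω w).1 * (∏ v ∈ S, g (ω v).1) * f ω)
      (((hgm w).mul hP).mul hf),
    lintegral_update_envLaw ν w
      (f := fun ω => (∏ v ∈ S, g (ω v).1) * (stoppedWeight x g w ω * f ω))
      (hP.mul (hs.mul hf))]
  refine lintegral_congr fun ω => ?_
  have hS : ∀ y, ∏ v ∈ S, g (Function.update ω w y v).1 = ∏ v ∈ S, g (ω v).1 := fun y =>
    Finset.prod_congr rfl fun v hv => by
      rw [Function.update_of_ne]; rintro rfl; exact hw hv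
  simp only [hS, Function.update_self]
  by_cases hx : x ≤ size ω w
  · refine lintegral_congr fun y => ?_
    simp only [stoppedWeight, size_update_self, Function.update_self, if_pos hx]
    ring
  -- Below size `x`, neither `f` nor the stopped weight sees the dislocation at `w`, and the raw
  -- weight integrates to one.
  · have h1 : ∀ y, f (Function.update ω w y) = f ω := fun y =>
      (hfs _ _ (agreeAbove_update (not_le.1 hx) y)).symm
    simp only [stoppedWeight, size_update_self, if_neg hx, h1, mul_assoc, one_mul]
    rw [lintegral_mul_const _ (f := fun y : MassPartition × ℝ => g y.1) (hg.comp measurable_fst),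
      lintegral_fst_prod_expMeasure ν hg, hg1]
    simp

/-- The weights are stopped one node at a time. A stopped weight is itself a stopped function and
can be absorbed into `f`, so the induction quantifies over `f` and needs no order on the nodes. -/
theorem lintegral_prod_mul_eq (ν : ProbabilityMeasure MassPartition)
    {g : MassPartition → ℝ≥0∞} (hg : Measurable g)
    (hg1 : ∫⁻ s, g s ∂(ν : Measure MassPartition) = 1) (x : ℝ) (T : Finset Node) :
    ∀ {f : Environment → ℝ≥0∞}, Measurable f → Stopped x f →
    ∫⁻ ω, (∏ v ∈ T, g (ω v).1) * f ω ∂envLaw ν =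
      ∫⁻ ω, (∏ v ∈ T, stoppedWeight x g v ω) * f ω ∂envLaw ν := by
  induction T using Finset.induction_on with
  | empty => simp
  | insert w S hw ih =>
    intro f hf hfs
    simp only [Finset.prod_insert hw]
    rw [lintegral_weight_mul_eq ν hg hg1 x w S hw hf hfs,
      ih (f := fun ω => stoppedWeight x g w ω * f ω)
        ((measurable_stoppedWeight x hg w).mul hf) fun ω ω' h => by
        simp only [stopped_stoppedWeight x g w ω ω' h, hfs ω ω' h]]
    refine lintegral_congr fun ω => ?_
    ring

/-- All the fragments of size at least `x` have their label in `T`. -/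
def Captured (x : ℝ) (T : Finset Node) : Set Environment := {ω | ∀ w, x ≤ size ω w → w ∈ T}

theorem measurableSet_captured (x : ℝ) (T : Finset Node) : MeasurableSet (Captured x T) := by
  have : Captured x T = ⋂ w, {ω | x ≤ size ω w → w ∈ T} := by ext; simp [Captured]
  rw [this]
  refine MeasurableSet.iInter fun w => ?_
  by_cases hw : w ∈ T
  · simp [hw]
  · simp only [hw, imp_false, not_le]
    exact measurableSet_lt (measurable_size w) measurable_const

theorem agreeAbove_of_captured {x : ℝ} {T : Finset Node} {ω ω' : Environment}
    (h : ω ∈ Captured x T) (hT : ∀ w ∈ T, ω w = ω' w) : AgreeAbove x ω ω' :=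
  fun w hw => hT w (h w hw)

theorem AgreeAbove.captured {x : ℝ} {T : Finset Node} {ω ω' : Environment}
    (h : AgreeAbove x ω ω') (hω : ω ∈ Captured x T) : ω' ∈ Captured x T :=
  fun w hw => hω w ((h.le_size_iff w).2 hw)

/-- The likelihood ratio of a tilted dislocation measure on the stopped events. -/
theorem envLaw_inter_captured (ν ν' : ProbabilityMeasure MassPartition)
    {g : MassPartition → ℝ≥0∞} (hg : Measurable g)
    (h : (ν' : Measure MassPartition) = (ν : Measure MassPartition).withDensity g) (x : ℝ)
    (T : Finset Node) {A : Set Environment} (hA : MeasurableSet A)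
    (hAs : Stopped x fun ω => ω ∈ A) :
    envLaw ν' (A ∩ Captured x T) =
      ∫⁻ ω, (∏ v ∈ T, stoppedWeight x g v ω) * (A ∩ Captured x T).indicator 1 ω ∂envLaw ν := by
  have hg1 : ∫⁻ s, g s ∂(ν : Measure MassPartition) = 1 := by
    rw [← setLIntegral_univ, ← withDensity_apply _ MeasurableSet.univ, ← h, measure_univ]
  have hD := hA.inter (measurableSet_captured x T)
  rw [← lintegral_prod_mul_eq ν hg hg1 x T (measurable_one.indicator hD)]
  · unfold envLaw
    refine infinitePi_apply_eq_lintegral _ _ (g := fun y : MassPartition × ℝ => g y.1)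
      (hg.comp measurable_fst) ?_ T hD ?_
    · rw [h, prod_withDensity_left hg]
    · rintro ω ω' hT ⟨h1, h2⟩
      have hag := agreeAbove_of_captured h2 hT
      exact ⟨(hAs ω ω' hag).mp h1, hag.captured h2⟩
  · intro ω ω' hag
    have : ω ∈ A ∩ Captured x T ↔ ω' ∈ A ∩ Captured x T :=
      and_congr (hAs ω ω' hag).to_iff ⟨hag.captured, hag.symm.captured⟩
    by_cases hω : ω ∈ A ∩ Captured x T
    · rw [indicator_of_mem hω, indicator_of_mem (this.1 hω)]; rfl
    · rw [indicator_of_notMem hω, indicator_of_notMem (mt this.2 hω)]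

/-! ### The number of large fragments -/

/-- The sum over the nodes of generation `n`. -/
def levelSum (n : ℕ) (φ : Node → ℝ≥0∞) : ℝ≥0∞ := ∑' w : Node, if w.length = n then φ w else 0

theorem levelSum_zero (φ : Node → ℝ≥0∞) : levelSum 0 φ = φ [] := by
  simp [levelSum, List.length_eq_zero_iff]

theorem levelSum_succ (n : ℕ) (φ : Node → ℝ≥0∞) :
    levelSum (n + 1) φ = levelSum n fun w => ∑' i, φ (i :: w) := by
  unfold levelSum
  have hinj : Function.Injective fun p : Node × ℕ => p.2 :: p.1 := by
    rintro ⟨a, b⟩ ⟨c, d⟩ h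
    simp only [List.cons.injEq] at h
    simp [h.1, h.2]
  rw [← hinj.tsum_eq, ENNReal.tsum_prod (f := fun (w : Node) i =>
    if (i :: w).length = n + 1 then φ (i :: w) else 0)]
  · refine tsum_congr fun w => ?_
    by_cases h : w.length = n <;> simp [h]
  · rintro (_ | ⟨i, w⟩) h
    · simp at h
    · exact ⟨(w, i), rfl⟩

theorem levelSum_mono {n : ℕ} {φ ψ : Node → ℝ≥0∞} (h : ∀ w, φ w ≤ ψ w) :
    levelSum n φ ≤ levelSum n ψ :=
  ENNReal.tsum_le_tsum fun w => by split_ifs <;> simp [h]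

theorem levelSum_add (n : ℕ) (φ ψ : Node → ℝ≥0∞) :
    levelSum n (fun w => φ w + ψ w) = levelSum n φ + levelSum n ψ := by
  unfold levelSum
  rw [← ENNReal.tsum_add]
  exact tsum_congr fun w => by split_ifs <;> simp

theorem levelSum_mul_left (n : ℕ) (a : ℝ≥0∞) (φ : Node → ℝ≥0∞) :
    levelSum n (fun w => a * φ w) = a * levelSum n φ := by
  unfold levelSum
  rw [← ENNReal.tsum_mul_left]
  exact tsum_congr fun w => by split_ifs <;> simp

theorem tsum_levelSum (φ : Node → ℝ≥0∞) : ∑' n, levelSum n φ = ∑' w, φ w := by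
  unfold levelSum
  rw [ENNReal.tsum_comm]
  exact tsum_congr fun w => by simp

theorem tsum_ofReal_mul_part_le {y : ℝ} (hy : 0 ≤ y) (s : MassPartition) :
    ∑' i, ENNReal.ofReal (y * s.1 i) ≤ ENNReal.ofReal y := by
  rw [← ENNReal.ofReal_tsum_of_nonneg (fun i => mul_nonneg hy (s.nonneg i))
    (s.2.2.2.1.mul_left y), tsum_mul_left]
  exact ENNReal.ofReal_le_ofReal (mul_le_of_le_one_right hy s.2.2.2.2)

/-- The total mass of a generation is at most one. -/
theorem levelSum_size_le_one (ω : Environment) (n : ℕ) :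
    levelSum n (fun w => ENNReal.ofReal (size ω w)) ≤ 1 := by
  induction n with
  | zero => simp [levelSum_zero, size]
  | succ n ih =>
    rw [levelSum_succ]
    exact (levelSum_mono fun w => tsum_ofReal_mul_part_le (size_nonneg ω w) (ω w).1).trans ih

/-- A subadditive potential: it grows by one when a fragment of size at least `x` splits into two
pieces of relative size at least `1 / 4`. -/
def potential (x y : ℝ) : ℝ≥0∞ := ENNReal.ofReal (min (4 / x * y) 1)

theorem measurable_potential (x : ℝ) : Measurable (potential x) := by
  unfold potential; fun_prop

theorem potential_le {x : ℝ} (y : ℝ) :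
    potential x y ≤ ENNReal.ofReal (4 / x * y) :=
  ENNReal.ofReal_le_ofReal (min_le_left _ _)

/-- The map `y ↦ min (4 y / x) 1` is subadditive on nonnegative reals. In the balanced case both
pieces have size at least `x / 4`, where the potential saturates, so the right side is `2`. -/
theorem potential_add_le {x y a b : ℝ} (hx : 0 < x) (hy : 0 ≤ y) (ha : 0 ≤ a) (hb : 0 ≤ b)
    (hba : b ≤ a) (hab : a + b = 1) :
    potential x y + {z : ℝ × ℝ | x ≤ z.1 ∧ z.2 ≤ 3 / 4}.indicator 1 (y, a) ≤
      potential x (y * a) + potential x (y * b) := by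
  have hc : 0 < 4 / x := by positivity
  have h0 : 0 ≤ 4 / x * y := by positivity
  have hA : 0 ≤ 4 / x * (y * a) := by positivity
  have hB : 0 ≤ 4 / x * (y * b) := by positivity
  have hAB : 4 / x * y = 4 / x * (y * a) + 4 / x * (y * b) := by
    rw [← mul_add, ← mul_add, hab, mul_one]
  unfold potential
  by_cases h : x ≤ y ∧ a ≤ 3 / 4
  · rw [indicator_of_mem (by exact h)]
    have key : ∀ z : ℝ, 1 / 4 ≤ z → 1 ≤ 4 / x * (y * z) := by
      intro z hz
      have : 1 = 4 / x * (x * (1 / 4)) := by field_simp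
      rw [this]
      gcongr
      exact h.1
    have h4 : 1 / 4 ≤ b := by linarith [h.2]
    rw [min_eq_right (key a (h4.trans hba)), min_eq_right (key b h4)]
    gcongr
    · exact min_le_right _ _
    · simp
  · rw [indicator_of_notMem (by exact h), add_zero, ← ENNReal.ofReal_add (by positivity)
      (by positivity), hAB]
    refine ENNReal.ofReal_le_ofReal ?_
    rcases le_total (4 / x * (y * a)) 1 with h1 | h1 <;>
    rcases le_total (4 / x * (y * b)) 1 with h2 | h2 <;>
    simp only [min_eq_left, min_eq_right, h1, h2] <;>
    first
    | exact min_le_left _ _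
    | exact (min_le_right _ _).trans (by linarith)

/-- `potential_add_le` is averaged over the dislocation at `w`, which is independent of the size of
`w`; the expected gain is the probability of a balanced split times that of being large. -/
theorem lintegral_potential_add_le {ν : ProbabilityMeasure MassPartition} (hν : Binary ν) {x : ℝ}
    (hx : 0 < x) (w : Node) :
    ∫⁻ ω, potential x (size ω w) ∂envLaw ν +
        (ν : Measure MassPartition) {s | s.1 0 ≤ 3 / 4} * envLaw ν {ω | x ≤ size ω w} ≤
      ∑' i, ∫⁻ ω, potential x (size ω (i :: w)) ∂envLaw ν := by
  have hms : MeasurableSet {s : MassPartition | s.1 0 ≤ 3 / 4} :=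
    measurableSet_le (MassPartition.measurable_part 0) measurable_const
  have hmw : MeasurableSet {ω : Environment | x ≤ size ω w} :=
    measurableSet_le measurable_const (measurable_size w)
  have hpm : ∀ u, Measurable fun ω : Environment => potential x (size ω u) := fun u =>
    (measurable_potential x).comp (measurable_size u)
  rw [← lintegral_tsum fun i => (hpm _).aemeasurable]
  rw [lintegral_update_envLaw ν w (f := fun ω => ∑' i, potential x (size ω (i :: w)))
    (Measurable.tsum fun i => hpm _)]
  rw [← lintegral_indicator_one hmw, ← lintegral_const_mul _ (measurable_one.indicator hmw),
    ← lintegral_add_left (hpm w)]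
  refine lintegral_mono fun ω => ?_
  simp only [size, size_update_self, Function.update_self]
  have hmi : ∀ i, Measurable fun s : MassPartition => potential x (size ω w * s.1 i) := fun i =>
    (measurable_potential x).comp ((MassPartition.measurable_part i).const_mul _)
  rw [lintegral_fst_prod_expMeasure ν (g := fun s => ∑' i, potential x (size ω w * s.1 i))
    (Measurable.tsum hmi)]
  have e : potential x (size ω w) + (ν : Measure MassPartition) {s | s.1 0 ≤ 3 / 4} *
      {ω | x ≤ size ω w}.indicator 1 ω =
      ∫⁻ s, potential x (size ω w) +
        {z : ℝ × ℝ | x ≤ z.1 ∧ z.2 ≤ 3 / 4}.indicator 1 (size ω w, s.1 0)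
        ∂(ν : Measure MassPartition) := by
    rw [lintegral_add_left measurable_const, lintegral_const, measure_univ, mul_one]
    congr 1
    by_cases h : x ≤ size ω w
    · rw [indicator_of_mem (by exact h), Pi.one_apply, mul_one, ← lintegral_indicator_one hms]
      refine lintegral_congr fun s => ?_
      simp [indicator, h]
    · simp [indicator, h]
  rw [e]
  refine lintegral_mono_ae ?_
  filter_upwards [hν] with s hs
  refine (potential_add_le hx (size_nonneg ω w) (s.nonneg 0) (s.nonneg 1)
    (s.2.1 zero_le_one) hs).trans ?_
  refine le_trans ?_ (ENNReal.sum_le_tsum (Finset.range 2))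
  simp [Finset.sum_range_succ]

/-- The expected number of fragments of size at least `x` is of order at most `1 / x`. -/
theorem mul_tsum_measure_size_le {ν : ProbabilityMeasure MassPartition} (hν : Binary ν) {x : ℝ}
    (hx : 0 < x) :
    (ν : Measure MassPartition) {s | s.1 0 ≤ 3 / 4} *
      ∑' w, envLaw ν {ω | x ≤ size ω w} ≤ ENNReal.ofReal (4 / x) := by
  set p := (ν : Measure MassPartition) {s | s.1 0 ≤ 3 / 4}
  set b := fun w => envLaw ν {ω | x ≤ size ω w}
  set e : ℕ → ℝ≥0∞ := fun n => levelSum n fun w => ∫⁻ ω, potential x (size ω w) ∂envLaw ν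
  -- Passing to the next generation raises the expected potential by at least `p` times the expected
  -- number of large fragments; these gains telescope.
  have hstep : ∀ n, e n + p * levelSum n b ≤ e (n + 1) := fun n => by
    simp only [e]
    rw [levelSum_succ, ← levelSum_mul_left, ← levelSum_add]
    exact levelSum_mono fun w => lintegral_potential_add_le hν hx w
  have hsum : ∀ n, p * ∑ m ∈ Finset.range n, levelSum m b ≤ e n := by
    intro n
    induction n with
    | zero => simp
    | succ n ih =>
      rw [Finset.sum_range_succ, mul_add]
      exact (add_le_add_left ih _).trans (hstep n)
  -- The potential is at most `4 / x` times the size, and a generation has total mass at most one.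
  have hbound : ∀ n, e n ≤ ENNReal.ofReal (4 / x) := by
    intro n
    have hsm : ∀ w, Measurable fun ω : Environment => ENNReal.ofReal (size ω w) := fun w =>
      (measurable_size w).ennreal_ofReal
    calc e n ≤ levelSum n fun w => ENNReal.ofReal (4 / x) *
          ∫⁻ ω, ENNReal.ofReal (size ω w) ∂envLaw ν := by
          refine levelSum_mono fun w => ?_
          rw [← lintegral_const_mul _ (hsm w)]
          refine lintegral_mono fun ω => ?_
          rw [← ENNReal.ofReal_mul (by positivity)]
          exact potential_le _
      _ = ENNReal.ofReal (4 / x) *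
          ∫⁻ ω, levelSum n (fun w => ENNReal.ofReal (size ω w)) ∂envLaw ν := by
          rw [levelSum_mul_left]
          congr 1
          unfold levelSum
          rw [lintegral_tsum]
          · refine tsum_congr fun w => ?_
            split_ifs <;> simp
          · intro w
            split_ifs
            · exact (hsm w).aemeasurable
            · exact aemeasurable_const
      _ ≤ ENNReal.ofReal (4 / x) * ∫⁻ _, 1 ∂envLaw ν := by
          gcongr with ω
          exact levelSum_size_le_one ω n
      _ = ENNReal.ofReal (4 / x) := by simp
  rw [← tsum_levelSum, ENNReal.tsum_eq_iSup_nat, ENNReal.mul_iSup]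
  exact iSup_le fun n => (hsum n).trans (hbound n)

theorem measure_compl_captured_le (ν : ProbabilityMeasure MassPartition) (x : ℝ)
    (T : Finset Node) :
    envLaw ν (Captured x T)ᶜ ≤ ∑' w : {w // w ∉ T}, envLaw ν {ω | x ≤ size ω w} := by
  refine (measure_mono ?_).trans (measure_iUnion_le _)
  intro ω hω
  simp only [Captured, mem_compl_iff, mem_ofPred_eq, not_forall] at hω
  obtain ⟨w, hw, hT⟩ := hω
  exact mem_iUnion.2 ⟨⟨w, hT⟩, hw⟩

/-- If the expected number of fragments of size at least `x` is finite, finitely many labels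
capture all these fragments with probability close to one. -/
theorem exists_measure_compl_captured_le {ν : ProbabilityMeasure MassPartition} {x : ℝ}
    (h : ∑' w, envLaw ν {ω | x ≤ size ω w} ≠ ∞) {δ : ℝ≥0∞} (hδ : 0 < δ) :
    ∃ T : Finset Node, envLaw ν (Captured x T)ᶜ ≤ δ := by
  obtain ⟨T, hT⟩ := ((ENNReal.tendsto_tsum_compl_atTop_zero h).eventually_le_const hδ).exists
  exact ⟨T, (measure_compl_captured_le ν x T).trans hT⟩

/-! ### The testing bound -/

/-- It makes the relative entropy of a tilt quadratic in `η`: the linear term vanishes for a centred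
direction. -/
theorem sub_two_mul_sq_le_log_one_add {u : ℝ} (hu : |u| ≤ 1 / 2) :
    u - 2 * u ^ 2 ≤ Real.log (1 + u) := by
  obtain ⟨h1, h2⟩ := abs_le.1 hu
  have hpos : 0 < 1 + u := by linarith
  refine le_trans ?_ (Real.one_sub_inv_le_log_of_pos hpos)
  rw [← sub_nonneg]
  have : 1 - (1 + u)⁻¹ - (u - 2 * u ^ 2) = u ^ 2 * (1 + 2 * u) / (1 + u) := by field_simp; ring
  rw [this]
  have : 0 ≤ 1 + 2 * u := by linarith
  positivity

/-- Integrated against `E L = 1` and `E log L ≥ -2K`, this gives `E min(1, L) ≥ exp(-2K) / 2`. With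
`a = exp(-K)` and `q = √L`, the bound `1 + z ≤ exp z` at `z = log q + K` gives `a (1 + log q + K) ≤
q`; then `a q` is compared with `1 + a² q² / 4` and with `q² + a² / 4` by completing squares. -/
theorem min_one_ge {L K : ℝ} (hL : 0 < L) :
    Real.exp (-(2 * K)) * (1 + Real.log L / 2 + K) - Real.exp (-(2 * K)) / 4 * (1 + L) ≤
      min 1 L := by
  obtain ⟨r, rfl⟩ : ∃ r, L = Real.exp r := ⟨Real.log L, (Real.exp_log hL).symm⟩
  rw [Real.log_exp]
  set a := Real.exp (-K) with ha
  set q := Real.exp (r / 2) with hq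
  have e1 : Real.exp (-(2 * K)) = a ^ 2 := by rw [ha, ← Real.exp_nat_mul]; congr 1; push_cast; ring
  have e2 : Real.exp r = q ^ 2 := by rw [hq, ← Real.exp_nat_mul]; congr 1; push_cast; ring
  have h1 : a * (1 + r / 2 + K) ≤ q := by
    have h := Real.add_one_le_exp (r / 2 + K)
    have : q = a * Real.exp (r / 2 + K) := by rw [ha, ← Real.exp_add, hq]; congr 1; ring
    rw [this]
    exact mul_le_mul_of_nonneg_left (by linarith) (Real.exp_pos _).le
  have ha0 : 0 < a := Real.exp_pos _
  have hq0 : 0 < q := Real.exp_pos _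
  have h2 : a ^ 2 * (1 + r / 2 + K) ≤ a * q := by nlinarith
  rw [e1, e2]
  refine le_min ?_ ?_
  · nlinarith [sq_nonneg (1 - a / 2 * q)]
  · nlinarith [sq_nonneg (q - a / 2)]

theorem stoppedWeight_ofReal (x : ℝ) (g : MassPartition → ℝ) (w : Node) (ω : Environment) :
    stoppedWeight x (fun s => ENNReal.ofReal (g s)) w ω =
      ENNReal.ofReal (stoppedWeight x g w ω) := by
  unfold stoppedWeight
  split_ifs <;> simp

/-- The size of `w` is decided by its ancestors, hence is independent of its own dislocation. Summed
over nodes, this is Wald's identity for the log-likelihood. -/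
theorem integral_log_stoppedWeight (ν : ProbabilityMeasure MassPartition) (x : ℝ)
    {g : MassPartition → ℝ} (hg : Measurable g) {C : ℝ} (hC : ∀ s, |Real.log (g s)| ≤ C)
    (w : Node) :
    Integrable (fun ω => Real.log (stoppedWeight x g w ω)) (envLaw ν) ∧
    ∫ ω, Real.log (stoppedWeight x g w ω) ∂envLaw ν =
      (envLaw ν).real {ω | x ≤ size ω w} * ∫ s, Real.log (g s) ∂(ν : Measure MassPartition) := by
  have hmw : MeasurableSet {ω : Environment | x ≤ size ω w} :=
    measurableSet_le measurable_const (measurable_size w)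
  have hC0 : 0 ≤ C := (abs_nonneg _).trans (hC (Classical.arbitrary _))
  have hint : Integrable (fun ω => Real.log (stoppedWeight x g w ω)) (envLaw ν) := by
    refine Integrable.of_bound
      (Real.measurable_log.comp (measurable_stoppedWeight x hg w)).aestronglyMeasurable C
      (ae_of_all _ fun ω => ?_)
    unfold stoppedWeight
    split_ifs
    · exact hC _
    · simpa using hC0
  refine ⟨hint, ?_⟩
  have h := integral_update_infinitePi
    (fun _ : Node => (ν : Measure MassPartition).prod (expMeasure 1)) w hint
  refine h.trans ?_
  rw [← integral_indicator_one hmw, ← integral_mul_const]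
  refine integral_congr_ae (ae_of_all _ fun ω => ?_)
  simp only [stoppedWeight, size_update_self, Function.update_self]
  by_cases hx : x ≤ size ω w
  · simp only [hx, if_true, indicator, mem_ofPred_eq, Pi.one_apply, one_mul]
    rw [integral_fun_fst (fun s => Real.log (g s))]
    simp
  · simp [hx, indicator]

/-- A lower bound for the sum of the errors of a test between a dislocation measure and a
perturbation of it, when the test only depends on the fragments of size at least `x`. -/
theorem sum_errors_ge {ν ν' : ProbabilityMeasure MassPartition} {h : MassPartition → ℝ}
    (hm : Measurable h) (hb : ∀ s, |h s| ≤ 1) (h0 : ∫ s, h s ∂(ν : Measure MassPartition) = 0)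
    {η : ℝ} (hη0 : 0 ≤ η) (hη : η ≤ 1 / 2)
    (hν' : (ν' : Measure MassPartition) =
      (ν : Measure MassPartition).withDensity fun s => ENNReal.ofReal (1 + η * h s))
    {x K : ℝ} (hK : ENNReal.ofReal (η ^ 2) * ∑' w, envLaw ν {ω | x ≤ size ω w} ≤
      ENNReal.ofReal K) (hfin : ∑' w, envLaw ν {ω | x ≤ size ω w} ≠ ∞) (hK0 : 0 ≤ K)
    {A₀ A₁ : Set Environment} (hA₀ : MeasurableSet A₀) (hA₁ : MeasurableSet A₁)
    (hcover : ∀ ω, ω ∈ A₀ ∨ ω ∈ A₁) (hst : Stopped x fun ω => ω ∈ A₁) :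
    ENNReal.ofReal (Real.exp (-(2 * K)) / 4) ≤ envLaw ν A₀ + envLaw ν' A₁ := by
  set g : MassPartition → ℝ := fun s => 1 + η * h s
  have hu : ∀ s, |η * h s| ≤ η := fun s => by
    rw [abs_mul, abs_of_nonneg hη0]; exact mul_le_of_le_one_right hη0 (hb s)
  have hgm : Measurable g := by fun_prop
  have hgpos : ∀ s, 0 < g s := fun s => by
    have := (abs_le.1 (hu s)).1; simp only [g]; linarith
  have hlogb : ∀ s, |Real.log (g s)| ≤ 1 := fun s => by
    have h1 := (abs_le.1 (hu s))
    have h2 := Real.log_le_sub_one_of_pos (hgpos s)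
    have h3 := sub_two_mul_sq_le_log_one_add ((hu s).trans hη)
    have h4 : (η * h s) ^ 2 ≤ 1 / 4 := by
      rw [← sq_abs]; nlinarith [abs_nonneg (η * h s), hu s]
    simp only [g] at h2 ⊢
    rw [abs_le]; constructor <;> linarith
  -- The bound on `min 1 L` below yields `exp(-2K) / 2`; half of it is given up to the event that
  -- `T` misses a large fragment.
  obtain ⟨T, hT⟩ := exists_measure_compl_captured_le (ν := ν) hfin
    (δ := ENNReal.ofReal (Real.exp (-(2 * K)) / 4)) (by simp [Real.exp_pos])
  have hwpos : ∀ w ω, 0 < stoppedWeight x g w ω := fun w ω => by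
    unfold stoppedWeight; split_ifs
    · exact hgpos _
    · exact one_pos
  set L : Environment → ℝ := fun ω => ∏ v ∈ T, stoppedWeight x g v ω
  have hLpos : ∀ ω, 0 < L ω := fun ω => Finset.prod_pos fun v _ => hwpos v ω
  have hLm : Measurable L := Finset.measurable_fun_prod _ fun v _ => measurable_stoppedWeight x hgm v
  have hprod : ∀ ω, ∏ v ∈ T, stoppedWeight x (fun s => ENNReal.ofReal (g s)) v ω =
      ENNReal.ofReal (L ω) := fun ω => by
    simp_rw [stoppedWeight_ofReal]
    rw [ENNReal.ofReal_prod_of_nonneg fun v _ => (hwpos v ω).le]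
  -- The stopped product has the same mean as the unstopped one, which is a probability density.
  have hL1 : ∫⁻ ω, ENNReal.ofReal (L ω) ∂envLaw ν = 1 := by
    have hg1 : ∫⁻ s, ENNReal.ofReal (g s) ∂(ν : Measure MassPartition) = 1 := by
      rw [← setLIntegral_univ, ← withDensity_apply _ MeasurableSet.univ, ← hν', measure_univ]
    have e1 := lintegral_prod_mul_eq ν hgm.ennreal_ofReal hg1 x T (f := fun _ => 1)
      measurable_const fun _ _ _ => rfl
    have e2 := infinitePi_apply_eq_lintegral _ ((ν' : Measure MassPartition).prod (expMeasure 1))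
      (g := fun y : MassPartition × ℝ => ENNReal.ofReal (g y.1))
      (hgm.ennreal_ofReal.comp measurable_fst)
      (by rw [hν', prod_withDensity_left hgm.ennreal_ofReal]) T (MeasurableSet.univ (α := Environment))
      fun _ _ _ _ => mem_univ _
    simp only [hprod, mul_one] at e1
    rw [measure_univ] at e2
    simp only [indicator_univ, Pi.one_apply, mul_one] at e2
    exact e1.symm.trans e2.symm
  have hLint : Integrable L (envLaw ν) := by
    refine ⟨hLm.aestronglyMeasurable, ?_⟩
    rw [hasFiniteIntegral_iff_ofReal (ae_of_all _ fun ω => (hLpos ω).le), hL1]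
    exact ENNReal.one_lt_top
  have hLint1 : ∫ ω, L ω ∂envLaw ν = 1 := by
    rw [integral_eq_lintegral_of_nonneg_ae (ae_of_all _ fun ω => (hLpos ω).le)
      hLm.aestronglyMeasurable, hL1]; simp
  have hlogL : ∀ ω, Real.log (L ω) = ∑ v ∈ T, Real.log (stoppedWeight x g v ω) := fun ω =>
    Real.log_prod fun v _ => (hwpos v ω).ne'
  have hlogint : Integrable (fun ω => Real.log (L ω)) (envLaw ν) := by
    simp_rw [hlogL]
    exact integrable_finsetSum _ fun v _ => (integral_log_stoppedWeight ν x hgm hlogb v).1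
  -- Each large fragment costs at most `2 η²`, and `η²` times their expected number is at most `K`.
  have hlog : -(2 * K) ≤ ∫ ω, Real.log (L ω) ∂envLaw ν := by
    have hElog : -(2 * η ^ 2) ≤ ∫ s, Real.log (g s) ∂(ν : Measure MassPartition) := by
      have hhi : Integrable h (ν : Measure MassPartition) :=
        Integrable.of_bound hm.aestronglyMeasurable 1 (ae_of_all _ hb)
      calc -(2 * η ^ 2) = ∫ s, (η * h s - 2 * η ^ 2) ∂(ν : Measure MassPartition) := by
            rw [integral_sub (hhi.const_mul _) (integrable_const _), integral_const_mul, h0]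
            simp
        _ ≤ _ := by
            refine integral_mono ((hhi.const_mul _).sub (integrable_const _))
              (Integrable.of_bound (Real.measurable_log.comp hgm).aestronglyMeasurable 1
                (ae_of_all _ hlogb)) fun s => ?_
            refine le_trans ?_ (sub_two_mul_sq_le_log_one_add ((hu s).trans hη))
            have : (η * h s) ^ 2 ≤ η ^ 2 := sq_le_sq' (abs_le.1 (hu s)).1 (abs_le.1 (hu s)).2
            simp only; linarith
    have hsum : η ^ 2 * ∑ v ∈ T, (envLaw ν).real {ω | x ≤ size ω v} ≤ K := by
      have h1 : ENNReal.ofReal (η ^ 2) * ∑ v ∈ T, envLaw ν {ω | x ≤ size ω v} ≤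
          ENNReal.ofReal K :=
        (mul_le_mul_right (ENNReal.sum_le_tsum T) _).trans hK
      have h2 := ENNReal.toReal_mono ENNReal.ofReal_ne_top h1
      rw [ENNReal.toReal_mul, ENNReal.toReal_sum fun v _ => measure_ne_top _ _,
        ENNReal.toReal_ofReal (by positivity), ENNReal.toReal_ofReal (by positivity)] at h2
      exact h2
    simp_rw [hlogL]
    rw [integral_finsetSum _ fun v _ => (integral_log_stoppedWeight ν x hgm hlogb v).1]
    simp_rw [(integral_log_stoppedWeight ν x hgm hlogb _).2]
    rw [← Finset.sum_mul]
    have hn : 0 ≤ ∑ v ∈ T, (envLaw ν).real {ω | x ≤ size ω v} :=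
      Finset.sum_nonneg fun _ _ => measureReal_nonneg
    nlinarith
  have hminint : Integrable (fun ω => min 1 (L ω)) (envLaw ν) := by
    exact (integrable_const 1).inf hLint
  have hmin : Real.exp (-(2 * K)) / 2 ≤ ∫ ω, min 1 (L ω) ∂envLaw ν := by
    have hi1 : Integrable (fun ω => 1 + Real.log (L ω) / 2 + K) (envLaw ν) :=
      ((integrable_const _).add (hlogint.div_const 2)).add (integrable_const _)
    have hi2 : Integrable (fun ω => 1 + L ω) (envLaw ν) := (integrable_const _).add hLint
    have hle := integral_mono ((hi1.const_mul (Real.exp (-(2 * K)))).sub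
      (hi2.const_mul (Real.exp (-(2 * K)) / 4))) hminint fun ω => min_one_ge (K := K) (hLpos ω)
    refine le_trans ?_ hle
    have e1 : ∫ ω, (1 + Real.log (L ω) / 2 + K) ∂envLaw ν =
        1 + (∫ ω, Real.log (L ω) ∂envLaw ν) / 2 + K := by
      rw [integral_add (f := fun ω => 1 + Real.log (L ω) / 2)
        ((integrable_const _).add (hlogint.div_const 2)) (integrable_const _),
        integral_add (integrable_const _) (hlogint.div_const 2), integral_div]
      simp
    have e2 : ∫ ω, (1 + L ω) ∂envLaw ν = 2 := by
      rw [integral_add (integrable_const _) hLint, hLint1]; simp; norm_num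
    simp only [Pi.sub_apply]
    rw [integral_sub (hi1.const_mul _) (hi2.const_mul _), integral_const_mul, integral_const_mul,
      e1, e2]
    nlinarith [Real.exp_pos (-(2 * K))]
  have hC := measurableSet_captured x T
  have hD := hA₁.inter hC
  have hchange := envLaw_inter_captured ν ν' hgm.ennreal_ofReal hν' x T hA₁ hst
  simp_rw [hprod] at hchange
  have hfinal : ENNReal.ofReal (Real.exp (-(2 * K)) / 2) ≤
      envLaw ν A₀ + envLaw ν' A₁ + envLaw ν (Captured x T)ᶜ := by
    calc ENNReal.ofReal (Real.exp (-(2 * K)) / 2)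
        ≤ ENNReal.ofReal (∫ ω, min 1 (L ω) ∂envLaw ν) := ENNReal.ofReal_le_ofReal hmin
      _ = ∫⁻ ω, ENNReal.ofReal (min 1 (L ω)) ∂envLaw ν :=
          ofReal_integral_eq_lintegral_ofReal hminint
            (ae_of_all _ fun ω => le_min zero_le_one (hLpos ω).le)
      _ ≤ ∫⁻ ω, (A₀.indicator 1 ω + ENNReal.ofReal (L ω) * (A₁ ∩ Captured x T).indicator 1 ω) +
            (Captured x T)ᶜ.indicator 1 ω ∂envLaw ν := by
          -- Pointwise, `min 1 L` is at most `1` on `A₀` and off the captured event, and at most `L`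
          -- on the captured part of `A₁`.
          refine lintegral_mono fun ω => ?_
          by_cases hc : ω ∈ Captured x T
          · rcases hcover ω with ha | ha
            · refine le_trans ?_ (le_trans le_self_add le_self_add)
              simp [ha]
            · refine le_trans ?_ (le_trans le_add_self le_self_add)
              simp [ha, hc]
          · refine le_trans ?_ le_add_self
            simp [hc]
      _ = envLaw ν A₀ + envLaw ν' (A₁ ∩ Captured x T) + envLaw ν (Captured x T)ᶜ := by
          rw [lintegral_add_right _ (measurable_one.indicator hC.compl),
            lintegral_add_left (measurable_one.indicator hA₀), lintegral_indicator_one hA₀,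
            lintegral_indicator_one hC.compl, hchange]
      _ ≤ _ := by gcongr; exact inter_subset_left
  have hsplit : ENNReal.ofReal (Real.exp (-(2 * K)) / 2) =
      ENNReal.ofReal (Real.exp (-(2 * K)) / 4) + ENNReal.ofReal (Real.exp (-(2 * K)) / 4) := by
    rw [← ENNReal.ofReal_add (by positivity) (by positivity)]; congr 1; ring
  rw [hsplit] at hfinal
  exact ENNReal.le_of_add_le_add_right ENNReal.ofReal_ne_top
    (hfinal.trans (add_le_add_right hT _))

/-! ### The Lévy measure -/

/-- The sum of a function of `-log sᵢ` over the nonzero parts of `s`, weighted by `sᵢ`. -/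
def sizeBiasedSum (f : ℝ → ℝ≥0∞) (s : MassPartition) : ℝ≥0∞ :=
  ∑' i, {s : MassPartition | 0 < s.1 i}.indicator
    (fun s => ENNReal.ofReal (s.1 i) * f (-Real.log (s.1 i))) s

theorem measurableSet_part_pos (i : ℕ) : MeasurableSet {s : MassPartition | 0 < s.1 i} :=
  measurableSet_lt measurable_const (MassPartition.measurable_part i)

theorem measurable_sizeBiasedSum {f : ℝ → ℝ≥0∞} (hf : Measurable f) :
    Measurable (sizeBiasedSum f) := by
  have hp := MassPartition.measurable_part
  refine Measurable.tsum fun i => Measurable.indicator ?_ (measurableSet_part_pos i)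
  exact (hp i).ennreal_ofReal.mul (hf.comp (Real.measurable_log.comp (hp i)).neg)

/-- Under `x = -log sᵢ` the factor `exp(-x)` becomes the size-bias `sᵢ`. -/
theorem lintegral_levyMeasure (ν : ProbabilityMeasure MassPartition) {f : ℝ → ℝ≥0∞}
    (hf : Measurable f) :
    ∫⁻ x, f x ∂levyMeasure ν = ∫⁻ s, sizeBiasedSum f s ∂(ν : Measure MassPartition) := by
  have hp := MassPartition.measurable_part
  have hlog : ∀ i, Measurable fun s : MassPartition => -Real.log (s.1 i) := fun i =>
    (Real.measurable_log.comp (hp i)).neg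
  have he : Measurable fun x : ℝ => ENNReal.ofReal (Real.exp (-x)) := by fun_prop
  have hm : ∀ i, Measurable ({s : MassPartition | 0 < s.1 i}.indicator
    (fun s => ENNReal.ofReal (s.1 i) * f (-Real.log (s.1 i)))) := fun i =>
    Measurable.indicator ((hp i).ennreal_ofReal.mul (hf.comp (hlog i))) (measurableSet_part_pos i)
  unfold levyMeasure sizeBiasedSum
  rw [lintegral_withDensity_eq_lintegral_mul _ he hf, lintegral_sum_measure,
    lintegral_tsum fun i => (hm i).aemeasurable]
  refine tsum_congr fun i => ?_
  rw [lintegral_map (he.mul hf) (hlog i), ← lintegral_indicator (measurableSet_part_pos i)]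
  refine lintegral_congr fun s => ?_
  by_cases hs : 0 < s.1 i
  · simp [indicator, hs, Real.exp_log hs]
  · simp [indicator, hs]

theorem levyMeasure_le {ν ν' : ProbabilityMeasure MassPartition} {c : ℝ≥0∞}
    (h : (ν : Measure MassPartition) ≤ c • (ν' : Measure MassPartition)) :
    levyMeasure ν ≤ c • levyMeasure ν' := by
  refine Measure.le_iff.2 fun A hA => ?_
  rw [Measure.smul_apply, ← lintegral_indicator_one hA, ← lintegral_indicator_one hA,
    lintegral_levyMeasure ν (measurable_one.indicator hA),
    lintegral_levyMeasure ν' (measurable_one.indicator hA), ← lintegral_smul_measure]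
  exact lintegral_mono' h le_rfl

instance (ν : ProbabilityMeasure MassPartition) : SFinite (levyMeasure ν) := by
  unfold levyMeasure; infer_instance

/-! ### Stability of the model -/

theorem SpreadOut.ne_zero {π : Measure ℝ} (h : SpreadOut π) : π ≠ 0 := by
  rintro rfl
  obtain ⟨n, hn, h⟩ := h
  obtain ⟨m, rfl⟩ := Nat.exists_eq_add_of_le' hn
  simp [convPow] at h

/-- The first convolution power suffices: the measure is its own absolutely continuous part. -/
theorem spreadOut_of_absolutelyContinuous {π : Measure ℝ} [SFinite π] (h : π ≪ volume)
    (h0 : π ≠ 0) : SpreadOut π := by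
  refine ⟨1, le_rfl, ?_⟩
  have : convPow π 1 = π := by simp [convPow]
  rw [this, Measure.withDensity_rnDeriv_eq _ _ h]
  exact h0

theorem ExpMomentReal.of_le {π π' : Measure ℝ} [SFinite π'] {κ : ℝ} (h : ExpMomentReal κ π)
    {c : ℝ≥0∞} (hc : c ≠ ∞) (hle : π' ≤ c • π) (hac : π' ≪ volume) (h0 : π' ≠ 0) :
    ExpMomentReal κ π' := by
  refine ⟨spreadOut_of_absolutelyContinuous hac h0, ?_⟩
  refine (lintegral_mono' (Measure.restrict_mono le_rfl hle) le_rfl).trans_lt ?_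
  rw [Measure.restrict_smul, lintegral_smul_measure]
  exact ENNReal.mul_lt_top hc.lt_top h.2

theorem ExpMoment.of_le {π π' : Measure ℝ} [SFinite π'] {κ : ℝ≥0∞} (h : ExpMoment κ π)
    {c : ℝ≥0∞} (hc : c ≠ ∞) (hle : π' ≤ c • π) (hac : π' ≪ volume) (h0 : π' ≠ 0) :
    ExpMoment κ π' :=
  ⟨fun hκ => (h.1 hκ).of_le hc hle hac h0, fun hκ r hr => (h.2 hκ r hr).of_le hc hle hac h0⟩

theorem ExpMoment.ne_zero {π : Measure ℝ} {κ : ℝ≥0∞} (h : ExpMoment κ π) : π ≠ 0 := by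
  by_cases hκ : κ = ∞
  · exact (h.2 hκ 1 one_pos).1.ne_zero
  · exact (h.1 hκ).1.ne_zero

theorem DecayReal.of_le {π π' : Measure ℝ} [SFinite π'] {κ : ℝ} (h : DecayReal κ π)
    {c : ℝ≥0∞} (hc : c ≠ ∞) (hle : π' ≤ c • π) : DecayReal κ π' := by
  obtain ⟨p, hp, rfl, hlim⟩ := h
  have hac : π' ≪ volume := (Measure.absolutelyContinuous_of_le hle).trans
    ((Measure.smul_absolutelyContinuous).trans (withDensity_absolutelyContinuous _ _))
  have hcp : Measurable fun x => c * p x := hp.const_mul c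
  have hle' : π'.rnDeriv volume ≤ᵐ[volume] fun x => c * p x := by
    refine ae_le_of_forall_setLIntegral_le_of_sigmaFinite (Measure.measurable_rnDeriv _ _) ?_
    intro A hA _
    rw [← withDensity_apply _ hA, ← withDensity_apply _ hA, Measure.withDensity_rnDeriv_eq _ _ hac]
    refine (hle A).trans_eq ?_
    rw [← withDensity_smul _ hp]
    rfl
  -- The Radon–Nikodym derivative is below `c * p` only almost everywhere, whereas the `limsup` sees
  -- every point; the minimum is a version bounded everywhere.
  refine ⟨fun x => min (π'.rnDeriv volume x) (c * p x),
    (Measure.measurable_rnDeriv _ _).min hcp, ?_, ?_⟩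
  · conv_lhs => rw [← Measure.withDensity_rnDeriv_eq _ _ hac]
    refine withDensity_congr_ae ?_
    filter_upwards [hle'] with x hx using (min_eq_left hx).symm
  · calc _ ≤ limsup (fun x : ℝ => c * (ENNReal.ofReal (x ^ (-κ + 1)) * p x)) (𝓝[>] 0) := by
          refine limsup_le_limsup (Eventually.of_forall fun x => ?_)
          beta_reduce
          rw [mul_left_comm c]
          gcongr
          exact min_le_right _ _
      _ = c * limsup (fun x : ℝ => ENNReal.ofReal (x ^ (-κ + 1)) * p x) (𝓝[>] 0) :=
          ENNReal.limsup_const_mul_of_ne_top hc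
      _ < ∞ := ENNReal.mul_lt_top hc.lt_top hlim

theorem Decay.of_le {π π' : Measure ℝ} [SFinite π'] {κ : ℝ≥0∞} (h : Decay κ π)
    {c : ℝ≥0∞} (hc : c ≠ ∞) (hle : π' ≤ c • π) : Decay κ π' :=
  ⟨fun hκ => (h.1 hκ).of_le hc hle, fun hκ r hr => (h.2 hκ r hr).of_le hc hle⟩

theorem absolutelyContinuous_of_le_smul_measure {α : Type*} [MeasurableSpace α] {μ μ' : Measure α}
    {c : ℝ≥0∞} (h : μ' ≤ c • μ) : μ' ≪ μ :=
  (Measure.absolutelyContinuous_of_le h).trans Measure.smul_absolutelyContinuous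

theorem Regular.of_le {ν ν' : ProbabilityMeasure MassPartition} (h : Regular ν) {c : ℝ≥0∞}
    (hc : c ≠ ∞) (hle : (ν' : Measure MassPartition) ≤ c • (ν : Measure MassPartition))
    (hge : (ν : Measure MassPartition) ≤ c • (ν' : Measure MassPartition)) : Regular ν' where
  no_trivial := absolutelyContinuous_of_le_smul_measure hle h.no_trivial
  nontrivial := pos_iff_ne_zero.2 fun h0 =>
    h.nontrivial.ne' (absolutelyContinuous_of_le_smul_measure hge h0)
  finite_parts := fun ε hε => by
    refine (lintegral_mono' hle le_rfl).trans_lt ?_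
    rw [lintegral_smul_measure]
    exact ENNReal.mul_lt_top hc.lt_top (h.finite_parts ε hε)

/-- Null-set conditions, finite integrals and density bounds pass to a dominated measure. The
reverse domination keeps the charge of `s₁ ∈ (0, 1)` and prevents the Lévy measure from vanishing.
-/
theorem Model.of_le {κ₁ κ₂ : ℝ≥0∞} {ν ν' : ProbabilityMeasure MassPartition}
    (h : Model κ₁ κ₂ ν) {c : ℝ≥0∞} (hc : c ≠ ∞)
    (hle : (ν' : Measure MassPartition) ≤ c • (ν : Measure MassPartition))
    (hge : (ν : Measure MassPartition) ≤ c • (ν' : Measure MassPartition)) : Model κ₁ κ₂ ν' := by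
  have hac : levyMeasure ν' ≪ volume :=
    (absolutelyContinuous_of_le_smul_measure (levyMeasure_le hle)).trans h.absolutelyContinuous
  have h0 : levyMeasure ν' ≠ 0 := fun h0 => h.expMoment.ne_zero <| by
    have := levyMeasure_le hge
    rw [h0, smul_zero] at this
    exact le_antisymm this (Measure.zero_le _)
  exact ⟨h.regular.of_le hc hle hge, absolutelyContinuous_of_le_smul_measure hle h.conservative, hac,
    h.expMoment.of_le hc (levyMeasure_le hle) hac h0, h.decay.of_le hc (levyMeasure_le hle)⟩

theorem Binary.of_le {ν ν' : ProbabilityMeasure MassPartition} (h : Binary ν) {c : ℝ≥0∞}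
    (hle : (ν' : Measure MassPartition) ≤ c • (ν : Measure MassPartition)) : Binary ν' :=
  absolutelyContinuous_of_le_smul_measure hle h

instance (ν : ProbabilityMeasure MassPartition) : IsProbabilityMeasure (splitLaw ν) :=
  Measure.isProbabilityMeasure_map (MassPartition.measurable_part 0).aemeasurable

theorem splitLaw_le {ν ν' : ProbabilityMeasure MassPartition} {c : ℝ≥0∞}
    (h : (ν : Measure MassPartition) ≤ c • (ν' : Measure MassPartition)) :
    splitLaw ν ≤ c • splitLaw ν' := by
  unfold splitLaw
  rw [← Measure.map_smul]
  exact Measure.map_mono h (MassPartition.measurable_part 0)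

theorem SplitDensityBoundedBelow.of_le {ν ν' : ProbabilityMeasure MassPartition}
    (h : SplitDensityBoundedBelow ν) {c : ℝ} (hc : 0 < c)
    (hle : (ν' : Measure MassPartition) ≤ ENNReal.ofReal c • (ν : Measure MassPartition))
    (hge : (ν : Measure MassPartition) ≤ ENNReal.ofReal c • (ν' : Measure MassPartition)) :
    SplitDensityBoundedBelow ν' := by
  obtain ⟨hac, δ, hδ, hb⟩ := h
  have hac' : splitLaw ν' ≪ volume :=
    (absolutelyContinuous_of_le_smul_measure (splitLaw_le hle)).trans hac
  have hle' : (splitLaw ν).rnDeriv volume ≤ᵐ[volume]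
      fun x => ENNReal.ofReal c * (splitLaw ν').rnDeriv volume x := by
    refine ae_le_of_forall_setLIntegral_le_of_sigmaFinite (Measure.measurable_rnDeriv _ _) ?_
    intro A hA _
    rw [lintegral_const_mul _ (Measure.measurable_rnDeriv _ _), ← withDensity_apply _ hA,
      ← withDensity_apply _ hA, Measure.withDensity_rnDeriv_eq _ _ hac,
      Measure.withDensity_rnDeriv_eq _ _ hac']
    exact splitLaw_le hge A
  refine ⟨hac', δ / c, by positivity, ?_⟩
  filter_upwards [hb, ae_restrict_of_ae hle'] with x h1 h2
  rw [ENNReal.ofReal_div_of_pos hc]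
  exact ENNReal.div_le_of_le_mul' (h1.trans h2)

/-! ### Moments of the Lévy measure -/

/-- The contribution of a mass partition to the moment of order `k` of the Lévy measure. -/
def massMoment (k : ℝ) : MassPartition → ℝ≥0∞ :=
  sizeBiasedSum ((Ioi (0 : ℝ)).indicator fun x => ENNReal.ofReal (x ^ k))

theorem measurable_indicator_rpow (k : ℝ) :
    Measurable ((Ioi (0 : ℝ)).indicator fun x => ENNReal.ofReal (x ^ k)) :=
  Measurable.indicator (by fun_prop) measurableSet_Ioi

theorem measurable_massMoment (k : ℝ) : Measurable (massMoment k) :=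
  measurable_sizeBiasedSum (measurable_indicator_rpow k)

/-- No integrability is needed: if the moment is infinite, both sides take the default value `0`. -/
theorem moment_levyMeasure (k : ℝ) (ν : ProbabilityMeasure MassPartition) :
    moment k (levyMeasure ν) = (∫⁻ s, massMoment k s ∂(ν : Measure MassPartition)).toReal := by
  unfold moment massMoment
  rw [← lintegral_levyMeasure ν (measurable_indicator_rpow k), lintegral_indicator
    measurableSet_Ioi, integral_eq_lintegral_of_nonneg_ae]
  · filter_upwards [ae_restrict_mem measurableSet_Ioi] with x hx using Real.rpow_nonneg (le_of_lt hx) k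
  · exact (by fun_prop : Measurable fun x : ℝ => x ^ k).aestronglyMeasurable

/-- This is `z ≤ exp z` at `z = r x / k`, raised to the power `k`; hence one positive exponential
moment controls all moments. -/
theorem rpow_le_mul_exp {k r x : ℝ} (hk : 0 < k) (hr : 0 < r) (hx : 0 ≤ x) :
    x ^ k ≤ (k / r) ^ k * Real.exp (r * x) := by
  have h : x ≤ k / r * Real.exp (r / k * x) := by
    have h1 : r / k * x ≤ Real.exp (r / k * x) := by linarith [Real.add_one_le_exp (r / k * x)]
    calc x = k / r * (r / k * x) := by field_simp
      _ ≤ _ := by gcongr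
  calc x ^ k ≤ (k / r * Real.exp (r / k * x)) ^ k := Real.rpow_le_rpow hx h hk.le
    _ = _ := by
      rw [Real.mul_rpow (by positivity) (Real.exp_pos _).le, ← Real.exp_mul]
      congr 2; field_simp

theorem ExpMoment.exists_pos {κ : ℝ≥0∞} (hκ : κ ≠ 0) {π : Measure ℝ} (h : ExpMoment κ π) :
    ∃ r : ℝ, 0 < r ∧ ExpMomentReal r π := by
  by_cases hi : κ = ∞
  · exact ⟨1, one_pos, h.2 hi 1 one_pos⟩
  · exact ⟨κ.toReal, ENNReal.toReal_pos hκ hi, h.1 hi⟩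

theorem lintegral_massMoment_lt_top {k r : ℝ} (hk : 0 < k) (hr : 0 < r)
    {ν : ProbabilityMeasure MassPartition} (h : ExpMomentReal r (levyMeasure ν)) :
    ∫⁻ s, massMoment k s ∂(ν : Measure MassPartition) < ∞ := by
  unfold massMoment
  rw [← lintegral_levyMeasure ν (measurable_indicator_rpow k)]
  calc ∫⁻ x, (Ioi (0 : ℝ)).indicator (fun x => ENNReal.ofReal (x ^ k)) x ∂levyMeasure ν
      ≤ ∫⁻ x, ENNReal.ofReal ((k / r) ^ k) * (Ici (0 : ℝ)).indicator
          (fun x => ENNReal.ofReal (Real.exp (r * x))) x ∂levyMeasure ν := by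
        refine lintegral_mono fun x => ?_
        by_cases hx : 0 < x
        · simp only [indicator, mem_Ioi, mem_Ici, hx, hx.le, if_true]
          rw [← ENNReal.ofReal_mul (by positivity)]
          exact ENNReal.ofReal_le_ofReal (rpow_le_mul_exp hk hr hx.le)
        · simp [indicator, hx]
    _ < ∞ := by
        rw [lintegral_const_mul _ (Measurable.indicator (by fun_prop) measurableSet_Ici),
          lintegral_indicator measurableSet_Ici]
        exact ENNReal.mul_lt_top ENNReal.ofReal_lt_top h.2

/-! ### Binary partitions and the choice of the direction. -/

/-- The mass moment of the partition `(a, 1 - a, 0, …)`. -/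
def binaryMoment (k a : ℝ) : ℝ := a * (-Real.log a) ^ k + (1 - a) * (-Real.log (1 - a)) ^ k

theorem massMoment_of_binary (k : ℝ) {s : MassPartition} (hs : s.1 0 + s.1 1 = 1)
    (h0 : s.1 0 ∈ Ioo (0 : ℝ) 1) : massMoment k s = ENNReal.ofReal (binaryMoment k (s.1 0)) := by
  -- The first two parts already exhaust the total mass.
  have hz : ∀ i, 2 ≤ i → s.1 i = 0 := by
    intro i hi
    have h := s.2.2.2.1.sum_le_tsum {0, 1, i} fun j _ => s.nonneg j
    rw [Finset.sum_insert (by simp; omega), Finset.sum_insert (by simp; omega),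
      Finset.sum_singleton] at h
    have := s.2.2.2.2
    have := s.nonneg i
    linarith
  have h1 : s.1 1 = 1 - s.1 0 := by linarith
  have hterm : ∀ a : ℝ, a ∈ Ioo (0 : ℝ) 1 →
      ENNReal.ofReal a * (Ioi (0 : ℝ)).indicator (fun x => ENNReal.ofReal (x ^ k)) (-Real.log a) =
        ENNReal.ofReal (a * (-Real.log a) ^ k) := by
    intro a ha
    have : 0 < -Real.log a := neg_pos.2 (Real.log_neg ha.1 ha.2)
    rw [indicator_of_mem (by exact this), ENNReal.ofReal_mul ha.1.le]
  have h1' : 1 - s.1 0 ∈ Ioo (0 : ℝ) 1 := ⟨by linarith [h0.2], by linarith [h0.1]⟩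
  have hnn : ∀ a : ℝ, a ∈ Ioo (0 : ℝ) 1 → 0 ≤ a * (-Real.log a) ^ k := fun a ha =>
    mul_nonneg ha.1.le (Real.rpow_nonneg (neg_nonneg.2 (Real.log_nonpos ha.1.le ha.2.le)) _)
  unfold massMoment sizeBiasedSum
  rw [tsum_eq_sum (s := Finset.range 2)]
  · have hm0 : s ∈ {s : MassPartition | 0 < s.1 0} := h0.1
    have hm1 : s ∈ {s : MassPartition | 0 < s.1 1} := h1'.1.trans_eq h1.symm
    rw [Finset.sum_range_succ, Finset.sum_range_one, indicator_of_mem hm0,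
      indicator_of_mem hm1, h1, hterm _ h0, hterm _ h1',
      ← ENNReal.ofReal_add (hnn _ h0) (hnn _ h1'), binaryMoment]
  · intro i hi
    rw [indicator_of_notMem]
    have : s.1 i = 0 := hz i (not_lt.1 (mt Finset.mem_range.2 hi))
    simp [this]

theorem continuousAt_binaryMoment_half {k : ℝ} (hk : 0 ≤ k) :
    ContinuousAt (binaryMoment k) (1 / 2) := by
  unfold binaryMoment
  have h1 : ContinuousAt (fun a : ℝ => -Real.log a) (1 / 2) :=
    (Real.continuousAt_log (by norm_num)).neg
  have h2 : ContinuousAt (fun a : ℝ => -Real.log (1 - a)) (1 / 2) :=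
    ((Real.continuousAt_log (by norm_num)).comp (by fun_prop)).neg
  exact (continuousAt_id.mul (h1.rpow_const (Or.inr hk))).add
    ((continuousAt_const.sub continuousAt_id).mul (h2.rpow_const (Or.inr hk)))

theorem binaryMoment_half (k : ℝ) : binaryMoment k (1 / 2) = Real.log 2 ^ k := by
  unfold binaryMoment
  rw [show (1 : ℝ) - 1 / 2 = 1 / 2 by norm_num, ← add_mul, one_div, Real.log_inv, neg_neg]
  norm_num

theorem tendsto_binaryMoment_one {k : ℝ} (hk : 0 < k) :
    Tendsto (binaryMoment k) (𝓝[<] 1) (𝓝 0) := by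
  have h1 : Tendsto (fun a : ℝ => a * (-Real.log a) ^ k) (𝓝[<] 1) (𝓝 0) := by
    have : ContinuousAt (fun a : ℝ => a * (-Real.log a) ^ k) 1 :=
      continuousAt_id.mul
        (((Real.continuousAt_log one_ne_zero).neg).rpow_const (Or.inr hk.le))
    have h := this.tendsto
    simp only [Real.log_one, neg_zero, Real.zero_rpow hk.ne', mul_zero] at h
    exact h.mono_left nhdsWithin_le_nhds
  have hsub : Tendsto (fun a : ℝ => 1 - a) (𝓝[<] 1) (𝓝[>] 0) := by
    refine tendsto_nhdsWithin_iff.2 ⟨?_, ?_⟩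
    · have : Tendsto (fun a : ℝ => 1 - a) (𝓝 1) (𝓝 (1 - 1)) :=
        (continuous_const.sub continuous_id).tendsto 1
      rw [sub_self] at this
      exact this.mono_left nhdsWithin_le_nhds
    · filter_upwards [self_mem_nhdsWithin] with a ha
      exact sub_pos.2 (mem_Iio.1 ha)
  -- With `u = -log x → ∞` this is `u ^ k * exp(-u) → 0`.
  have h2 : Tendsto (fun x : ℝ => x * (-Real.log x) ^ k) (𝓝[>] 0) (𝓝 0) := by
    have h := (tendsto_rpow_mul_exp_neg_mul_atTop_nhds_zero k 1 one_pos).comp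
      (tendsto_neg_atBot_atTop.comp Real.tendsto_log_nhdsGT_zero)
    refine h.congr' ?_
    filter_upwards [self_mem_nhdsWithin] with x hx
    simp [Real.exp_log hx, mul_comm]
  have := h1.add (h2.comp hsub)
  rw [add_zero] at this
  exact this

/-- A splitting law with a density bounded below charges all the subintervals. -/
theorem SplitDensityBoundedBelow.measure_pos {ν : ProbabilityMeasure MassPartition}
    (h : SplitDensityBoundedBelow ν) {a b : ℝ} (ha : 1 / 2 ≤ a) (hab : a < b) (hb : b ≤ 1) :
    0 < (ν : Measure MassPartition) {s | s.1 0 ∈ Ioo a b} := by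
  obtain ⟨_, δ, hδ, hbd⟩ := h
  have e : (ν : Measure MassPartition) {s | s.1 0 ∈ Ioo a b} = splitLaw ν (Ioo a b) :=
    (Measure.map_apply (MassPartition.measurable_part 0) measurableSet_Ioo).symm
  rw [e]
  have hsub : Ioo a b ⊆ Icc (1 / 2) 1 := fun x hx => ⟨ha.trans hx.1.le, hx.2.le.trans hb⟩
  calc (0 : ℝ≥0∞) < ENNReal.ofReal δ * volume (Ioo a b) := by
        rw [Real.volume_Ioo]
        exact ENNReal.mul_pos (by simpa using hδ) (by simpa using hab)
    _ = ∫⁻ _ in Ioo a b, ENNReal.ofReal δ := by simp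
    _ ≤ ∫⁻ x in Ioo a b, (splitLaw ν).rnDeriv volume x :=
        lintegral_mono_ae (ae_restrict_of_ae_restrict_of_subset hsub hbd)
    _ ≤ _ := Measure.setLIntegral_rnDeriv_le _

/-- The mass moment takes both large and small values with positive probability. -/
theorem exists_massMoment_threshold {k : ℝ} (hk : 0 < k) {ν : ProbabilityMeasure MassPartition}
    (hb : Binary ν) (hd : SplitDensityBoundedBelow ν) :
    ∃ t : ℝ, (ν : Measure MassPartition) {s | t < (massMoment k s).toReal} ≠ 0 ∧
      (ν : Measure MassPartition) {s | ¬ t < (massMoment k s).toReal} ≠ 0 := by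
  have hl : 0 < Real.log 2 ^ k := Real.rpow_pos_of_pos (Real.log_pos one_lt_two) k
  have hval : ∀ s : MassPartition, s.1 0 + s.1 1 = 1 → s.1 0 ∈ Ioo (1 / 2 : ℝ) 1 →
      (massMoment k s).toReal = max (binaryMoment k (s.1 0)) 0 := by
    intro s hs h0
    rw [massMoment_of_binary k hs ⟨by linarith [h0.1], h0.2⟩, ENNReal.toReal_ofReal']
  -- The threshold lies midway between the value at `a = 1/2` and the limit at `a = 1`; the
  -- splitting law charges intervals next to both points.
  refine ⟨Real.log 2 ^ k / 2, ?_, ?_⟩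
  · have hev : ∀ᶠ a in 𝓝[>] (1 / 2 : ℝ), Real.log 2 ^ k / 2 < binaryMoment k a := by
      refine ((continuousAt_binaryMoment_half hk.le).tendsto.mono_left
        nhdsWithin_le_nhds).eventually_const_lt ?_
      rw [binaryMoment_half]; linarith
    obtain ⟨b, hb1, hbI⟩ := (mem_nhdsGT_iff_exists_Ioo_subset' (show (1 / 2 : ℝ) < 1 by norm_num)).1
      (inter_mem hev (Ioo_mem_nhdsGT (show (1 / 2 : ℝ) < 1 by norm_num)))
    intro hzero
    have hpos := hd.measure_pos le_rfl (lt_min hb1 (by norm_num : (1 / 2 : ℝ) < 1))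
      (min_le_right _ _)
    refine hpos.ne' (measure_mono_null_ae ?_ hzero)
    filter_upwards [hb] with s hs hI
    have hI' := hbI ⟨hI.1, hI.2.trans_le (min_le_left _ _)⟩
    show _ < (massMoment k s).toReal
    rw [hval s hs hI'.2]
    exact lt_max_of_lt_left hI'.1
  · have hev : ∀ᶠ a in 𝓝[<] (1 : ℝ), binaryMoment k a < Real.log 2 ^ k / 2 :=
      (tendsto_binaryMoment_one hk).eventually_lt_const (by positivity)
    obtain ⟨a, ha1, haI⟩ := (mem_nhdsLT_iff_exists_Ioo_subset' (show (1 / 2 : ℝ) < 1 by norm_num)).1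
      (inter_mem hev (Ioo_mem_nhdsLT (show (1 / 2 : ℝ) < 1 by norm_num)))
    intro hzero
    have hpos := hd.measure_pos (le_max_right a (1 / 2)) (max_lt ha1 (by norm_num : (1 / 2 : ℝ) < 1))
      le_rfl
    refine hpos.ne' (measure_mono_null_ae ?_ hzero)
    filter_upwards [hb] with s hs hI
    have hI' := haI ⟨(le_max_left _ _).trans_lt hI.1, hI.2⟩
    show ¬ _ < (massMoment k s).toReal
    rw [hval s hs hI'.2, not_lt]
    exact max_le (le_of_lt hI'.1) (by positivity)

/-- A bounded centred direction that is positively correlated with a nonconstant integrable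
function. -/
theorem exists_correlated_direction {α : Type*} [MeasurableSpace α] (μ : Measure α)
    [IsProbabilityMeasure μ] {ψ : α → ℝ} (hψ : Measurable ψ) (hi : Integrable ψ μ) {t : ℝ}
    (h1 : μ {s | t < ψ s} ≠ 0) (h2 : μ {s | ¬ t < ψ s} ≠ 0) :
    ∃ h : α → ℝ, Measurable h ∧ (∀ s, |h s| ≤ 1) ∧ ∫ s, h s ∂μ = 0 ∧ 0 < ∫ s, h s * ψ s ∂μ := by
  set A := {s | t < ψ s} with hA
  have hAm : MeasurableSet A := measurableSet_lt measurable_const hψ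
  set p := μ.real A with hp
  have hp0 : 0 < p := ENNReal.toReal_pos h1 (measure_ne_top _ _)
  have hp1 : p < 1 := by
    have : 0 < μ.real Aᶜ := ENNReal.toReal_pos h2 (measure_ne_top _ _)
    rw [probReal_compl_eq_one_sub hAm] at this
    linarith
  have hm : Measurable fun s => A.indicator (1 : α → ℝ) s - p :=
    (measurable_one.indicator hAm).sub measurable_const
  have hb : ∀ s, |A.indicator (1 : α → ℝ) s - p| ≤ 1 := fun s => by
    by_cases hs : s ∈ A
    · simp only [hs, indicator_of_mem, Pi.one_apply, abs_le]; constructor <;> linarith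
    · simp only [hs, indicator_of_notMem, not_false_iff, abs_le]; constructor <;> linarith
  have hint : Integrable (fun s => A.indicator (1 : α → ℝ) s - p) μ :=
    Integrable.of_bound hm.aestronglyMeasurable 1 (ae_of_all _ hb)
  have hz : ∫ s, (A.indicator (1 : α → ℝ) s - p) ∂μ = 0 := by
    rw [integral_sub (f := A.indicator 1) ((integrable_const (1 : ℝ)).indicator hAm)
      (integrable_const _),
      integral_indicator_one hAm]
    simp [hp]
  refine ⟨_, hm, hb, hz, ?_⟩
  have hprod : Integrable (fun s => (A.indicator (1 : α → ℝ) s - p) * ψ s) μ :=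
    hi.bdd_mul hm.aestronglyMeasurable (c := 1) (ae_of_all _ hb)
  -- The centred indicator of `A` serves as the direction. Centring allows `ψ` to be replaced by `ψ
  -- - t`, whose product with it is nonnegative, and positive on `A`.
  have e : ∫ s, (A.indicator (1 : α → ℝ) s - p) * ψ s ∂μ =
      ∫ s, (A.indicator (1 : α → ℝ) s - p) * (ψ s - t) ∂μ := by
    simp_rw [mul_sub]
    rw [integral_sub hprod (hint.mul_const t), integral_mul_const, hz, zero_mul, sub_zero]
  rw [e, integral_pos_iff_support_of_nonneg]
  · refine (pos_iff_ne_zero.2 h1).trans_le (measure_mono fun s hs => ?_)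
    have : t < ψ s := hs
    simp only [Function.mem_support, indicator_of_mem hs, Pi.one_apply]
    exact mul_ne_zero (by linarith) (by linarith)
  · intro s
    by_cases hs : s ∈ A
    · have : t < ψ s := hs
      simp only [indicator_of_mem hs, Pi.one_apply, Pi.zero_apply]
      exact mul_nonneg (by linarith) (by linarith)
    · have : ψ s ≤ t := not_lt.1 hs
      simp only [indicator_of_notMem hs, Pi.zero_apply]
      exact mul_nonneg_of_nonpos_of_nonpos (by linarith) (by linarith)
  · simp_rw [mul_sub]
    exact hprod.sub (hint.mul_const t)

theorem moment_eq_integral {k : ℝ} {ν : ProbabilityMeasure MassPartition}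
    (h : ∫⁻ s, massMoment k s ∂(ν : Measure MassPartition) < ∞) :
    moment k (levyMeasure ν) = ∫ s, (massMoment k s).toReal ∂(ν : Measure MassPartition) := by
  rw [moment_levyMeasure, integral_toReal (measurable_massMoment k).aemeasurable
    (ae_lt_top (measurable_massMoment k) h.ne)]

/-- The moment of a tilted dislocation measure. -/
theorem moment_withDensity {k : ℝ} {ν ν' : ProbabilityMeasure MassPartition}
    (hfin : ∫⁻ s, massMoment k s ∂(ν : Measure MassPartition) < ∞)
    (hfin' : ∫⁻ s, massMoment k s ∂(ν' : Measure MassPartition) < ∞)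
    {h : MassPartition → ℝ} (hm : Measurable h) (hb : ∀ s, |h s| ≤ 1) {η : ℝ} (hη0 : 0 ≤ η)
    (hη : η ≤ 1 / 2)
    (hν' : (ν' : Measure MassPartition) =
      (ν : Measure MassPartition).withDensity fun s => ENNReal.ofReal (1 + η * h s)) :
    moment k (levyMeasure ν') = moment k (levyMeasure ν) +
      η * ∫ s, h s * (massMoment k s).toReal ∂(ν : Measure MassPartition) := by
  have hi : Integrable (fun s => (massMoment k s).toReal) (ν : Measure MassPartition) :=
    integrable_toReal_of_lintegral_ne_top (measurable_massMoment k).aemeasurable hfin.ne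
  have hp : Integrable (fun s => h s * (massMoment k s).toReal) (ν : Measure MassPartition) :=
    hi.bdd_mul hm.aestronglyMeasurable (c := 1) (ae_of_all _ hb)
  rw [moment_eq_integral hfin, moment_eq_integral hfin', hν',
    integral_withDensity_eq_integral_toReal_smul (by fun_prop)
      (ae_of_all _ fun _ => ENNReal.ofReal_lt_top), ← integral_const_mul,
    ← integral_add hi (hp.const_mul η)]
  refine integral_congr_ae (ae_of_all _ fun s => ?_)
  have : 0 ≤ 1 + η * h s := by nlinarith [(abs_le.1 (hb s)).1]
  simp only [ENNReal.toReal_ofReal this, smul_eq_mul]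
  ring

/-! ### Tilted dislocation measures -/

/-- Total mass one comes from the centring of `h`, nonnegativity from `|η h| ≤ 1/2`. -/
theorem exists_tilt (ν : ProbabilityMeasure MassPartition) {h : MassPartition → ℝ}
    (hm : Measurable h) (hb : ∀ s, |h s| ≤ 1) (h0 : ∫ s, h s ∂(ν : Measure MassPartition) = 0)
    {η : ℝ} (hη0 : 0 ≤ η) (hη : η ≤ 1 / 2) :
    ∃ ν' : ProbabilityMeasure MassPartition, (ν' : Measure MassPartition) =
      (ν : Measure MassPartition).withDensity fun s => ENNReal.ofReal (1 + η * h s) := by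
  have hhi : Integrable h (ν : Measure MassPartition) :=
    Integrable.of_bound hm.aestronglyMeasurable 1 (ae_of_all _ hb)
  have hone : IsProbabilityMeasure
      ((ν : Measure MassPartition).withDensity fun s => ENNReal.ofReal (1 + η * h s)) := by
    constructor
    rw [withDensity_apply _ MeasurableSet.univ, setLIntegral_univ,
      ← ofReal_integral_eq_lintegral_ofReal (f := fun s => 1 + η * h s)
        ((integrable_const 1).add (hhi.const_mul η)) (ae_of_all _ fun s => by
          have := (abs_le.1 (hb s)).1
          simp only [Pi.zero_apply]
          nlinarith),
      integral_add (integrable_const 1) (hhi.const_mul η), integral_const_mul, h0]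
    simp
  exact ⟨⟨_, hone⟩, rfl⟩

theorem tilt_le {ν ν' : ProbabilityMeasure MassPartition} {h : MassPartition → ℝ}
    (hm : Measurable h) (hb : ∀ s, |h s| ≤ 1) {η : ℝ} (hη0 : 0 ≤ η) (hη : η ≤ 1 / 2)
    (hν' : (ν' : Measure MassPartition) =
      (ν : Measure MassPartition).withDensity fun s => ENNReal.ofReal (1 + η * h s)) :
    (ν' : Measure MassPartition) ≤ ENNReal.ofReal 2 • (ν : Measure MassPartition) ∧
      (ν : Measure MassPartition) ≤ ENNReal.ofReal 2 • (ν' : Measure MassPartition) := by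
  have hu : ∀ s, |η * h s| ≤ 1 / 2 := fun s => by
    rw [abs_mul, abs_of_nonneg hη0]; exact (mul_le_of_le_one_right hη0 (hb s)).trans hη
  rw [hν']
  constructor
  · rw [← withDensity_const]
    refine withDensity_mono (ae_of_all _ fun s => ENNReal.ofReal_le_ofReal ?_)
    linarith [(abs_le.1 (hu s)).2]
  · rw [← withDensity_smul _ (by fun_prop)]
    conv_lhs => rw [← withDensity_one (μ := (ν : Measure MassPartition))]
    refine withDensity_mono (ae_of_all _ fun s => ?_)
    simp only [Pi.one_apply, Pi.smul_apply, smul_eq_mul]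
    rw [← ENNReal.ofReal_mul zero_le_two, ← ENNReal.ofReal_one]
    exact ENNReal.ofReal_le_ofReal (by linarith [(abs_le.1 (hu s)).1])

/-! ### The data -/

theorem measurable_noisySize (α σ : ℝ) (u : Node) : Measurable fun x => noisySize α σ x u := by
  unfold noisySize chain
  exact ((measurable_size u).comp measurable_fst).add
    (measurable_const.mul ((measurable_pi_apply u).comp measurable_snd))

theorem measurable_observation (α σ ε : ℝ) : Measurable (observation α σ ε) := by
  refine measurable_pi_lambda _ fun u => ?_
  unfold observation
  refine Measurable.ite ?_ (measurable_const.prodMk (measurable_noisySize α σ u)) measurable_const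
  rcases u with _ | ⟨i, w⟩
  · simp [observedNodes]
  · have : {x | i :: w ∈ observedNodes α σ ε x} =
        {x | ε ≤ noisySize α σ x w} ∩ {x | noisySize α σ x (i :: w) < ε} := by
      ext x
      constructor
      · rintro ⟨j, v, h, h1, h2⟩
        obtain ⟨-, rfl⟩ := List.cons.inj h
        exact ⟨h1, h2⟩
      · rintro ⟨h1, h2⟩
        exact ⟨i, w, rfl, h1, h2⟩
    rw [this]
    exact (measurableSet_le measurable_const (measurable_noisySize α σ w)).inter
      (measurableSet_lt (measurable_noisySize α σ (i :: w)) measurable_const)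

/-- With a noise of amplitude at most `ε / 2`, the data at stage `ε` only depend on the
dislocations of the fragments of size at least `ε / 2`. -/
theorem stopped_observation {α σ ε : ℝ} (hσ0 : 0 ≤ σ) (hσ : σ ≤ ε / 2) {U : Node → ℝ}
    (hU : ∀ u, |U u| ≤ 1) : Stopped (ε / 2) fun ω => observation α σ ε (ω, U) := by
  have hlarge : ∀ ω w, ε ≤ noisySize α σ (ω, U) w → ε / 2 ≤ size ω w := by
    intro ω w hw
    have h1 : σ * U w ≤ σ := mul_le_of_le_one_right hσ0 ((le_abs_self _).trans (hU w))
    simp only [noisySize, chain] at hw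
    linarith
  -- An observed child may be small, but its size is set by the dislocation of its parent, which is
  -- large.
  have hone : ∀ ω ω', AgreeAbove (ε / 2) ω ω' → ∀ i w, ε ≤ noisySize α σ (ω, U) w →
      noisySize α σ (ω', U) w = noisySize α σ (ω, U) w ∧
        noisySize α σ (ω', U) (i :: w) = noisySize α σ (ω, U) (i :: w) := by
    intro ω ω' h i w hw
    have hl := hlarge ω w hw
    simp only [noisySize, chain, size]
    rw [h.size_eq w hl, h w hl]
    exact ⟨rfl, rfl⟩
  have hsub : ∀ ω ω', AgreeAbove (ε / 2) ω ω' →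
      ∀ u ∈ observedNodes α σ ε (ω, U), u ∈ observedNodes α σ ε (ω', U) ∧
        noisySize α σ (ω', U) u = noisySize α σ (ω, U) u := by
    rintro ω ω' h _ ⟨i, w, rfl, h1, h2⟩
    obtain ⟨e1, e2⟩ := hone ω ω' h i w h1
    exact ⟨⟨i, w, rfl, e1.symm ▸ h1, e2.symm ▸ h2⟩, e2⟩
  intro ω ω' h
  funext u
  simp only [observation]
  by_cases hu : u ∈ observedNodes α σ ε (ω, U)
  · obtain ⟨h1, h2⟩ := hsub ω ω' h u hu
    rw [if_pos hu, if_pos h1, h2]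
  · rw [if_neg hu, if_neg fun h' => hu (hsub ω' ω h.symm u h').1]

/-- Two dislocation measures whose moments are `2 c r` apart cannot be told apart by an estimator
that only sees the fragments of size at least `ε / 2`. -/
theorem errorProb_add_ge {α k σ ε : ℝ} (hσ0 : 0 ≤ σ) (hσ : σ ≤ ε / 2)
    {Q : ProbabilityMeasure (Node → ℝ)} (hQ : IsNoise Q)
    {ν ν' : ProbabilityMeasure MassPartition} {δ : ℝ≥0∞}
    (htest : ∀ A₀ A₁ : Set Environment, MeasurableSet A₀ → MeasurableSet A₁ →
      (∀ ω, ω ∈ A₀ ∨ ω ∈ A₁) → (Stopped (ε / 2) fun ω => ω ∈ A₁) →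
      δ ≤ envLaw ν A₀ + envLaw ν' A₁) {r c : ℝ} (hr : 0 < r)
    (hsep : 2 * c * r ≤ |moment k (levyMeasure ν') - moment k (levyMeasure ν)|)
    {F : (Node → Bool × ℝ) → ℝ} (hF : Measurable F) :
    δ ≤ errorProb α k σ ε Q r c F ν + errorProb α k σ ε Q r c F ν' := by
  have hmeas : ∀ m : ℝ, MeasurableSet {x | c ≤ r⁻¹ * |F (observation α σ ε x) - m|} := fun m =>
    measurableSet_le measurable_const
      ((((hF.comp (measurable_observation α σ ε)).sub_const m).abs).const_mul _)
  unfold errorProb law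
  rw [Measure.prod_apply_symm (hmeas _), Measure.prod_apply_symm (hmeas _),
    ← lintegral_add_left (measurable_measure_prodMk_right (hmeas _))]
  have hUae : ∀ᵐ U ∂(Q : Measure (Node → ℝ)), ∀ u, |U u| ≤ 1 := ae_all_iff.2 hQ.bounded
  calc δ = ∫⁻ _, δ ∂(Q : Measure (Node → ℝ)) := by simp
    _ ≤ _ := by
      refine lintegral_mono_ae ?_
      -- The noise is independent of the fragmentation and has the same law under both hypotheses,
      -- so the test bound applies with `U` frozen.
      filter_upwards [hUae] with U hU
      refine htest _ _ (measurable_prodMk_right (hmeas _)) (measurable_prodMk_right (hmeas _)) ?_ ?_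
      · intro ω
        by_contra hcon
        simp only [mem_preimage, mem_ofPred_eq, not_or, not_le] at hcon
        obtain ⟨h1, h2⟩ := hcon
        -- Two errors below `c r` would contradict the separation of the moments by the triangle
        -- inequality.
        rw [inv_mul_lt_iff₀ hr] at h1 h2
        have := abs_sub_le (moment k (levyMeasure ν')) (F (observation α σ ε (ω, U)))
          (moment k (levyMeasure ν))
        rw [abs_sub_comm (moment k (levyMeasure ν')) (F _)] at this
        nlinarith
      · intro ω ω' h
        have := stopped_observation (α := α) hσ0 hσ hU ω ω' h
        simp only at this
        simp only [mem_preimage, mem_ofPred_eq, this]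

end Fragmentation

end

/-! ### The two-point lower bound. -/

open Fragmentation in
theorem theorem3 (α : ℝ) (hα : 0 ≤ α) (k : ℝ) (hk : 1 ≤ k)
    (κ₁ κ₂ : ℝ≥0∞) (hκ₂ : 0 < κ₂) (hκ : max 1 κ₂ < κ₁)
    (σ : ℝ → ℝ) (hσ : ∀ ε : ℝ, 0 < ε → 0 ≤ σ ε)
    (hσ_bound : σ =O[𝓝[>] 0] fun ε : ℝ => ε ^ 3)
    (Q : ProbabilityMeasure (Node → ℝ)) (hQ : IsNoise Q)
    (ν₀ : ProbabilityMeasure MassPartition) (hmodel : Model κ₁ κ₂ ν₀) (hbinary : Binary ν₀)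
    (hdensity : SplitDensityBoundedBelow ν₀) :
    IsLowerRate {ν | Model κ₁ κ₂ ν ∧ Binary ν ∧ SplitDensityBoundedBelow ν} α k σ Q ν₀
      (fun ε : ℝ => ε ^ (1 / 2 : ℝ)) := by
  have hk0 : 0 < k := one_pos.trans_le hk
  have hκ₁ : κ₁ ≠ 0 := (bot_le.trans_lt hκ).ne'
  have hfin : ∀ ν, Model κ₁ κ₂ ν → ∫⁻ s, massMoment k s ∂(ν : Measure MassPartition) < ∞ := by
    intro ν hν
    obtain ⟨r, hr, hexp⟩ := hν.expMoment.exists_pos hκ₁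
    exact lintegral_massMoment_lt_top hk0 hr hexp
  obtain ⟨t, ht1, ht2⟩ := exists_massMoment_threshold hk0 hbinary hdensity
  obtain ⟨h, hm, hb, hz, hcov⟩ := exists_correlated_direction (ν₀ : Measure MassPartition)
    (measurable_massMoment k).ennreal_toReal
    (integrable_toReal_of_lintegral_ne_top (measurable_massMoment k).aemeasurable
      (hfin ν₀ hmodel).ne) ht1 ht2
  set cov := ∫ s, h s * (massMoment k s).toReal ∂(ν₀ : Measure MassPartition)
  -- The cap makes the tilt a probability measure for every `ε`; it is inactive for `ε < 1/4`.
  set η : ℝ → ℝ := fun ε => min (√ε) (1 / 2)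
  have hη0 : ∀ ε, 0 ≤ η ε := fun ε => le_min (Real.sqrt_nonneg _) (by norm_num)
  have hη : ∀ ε, η ε ≤ 1 / 2 := fun ε => min_le_right _ _
  choose ν' hν' using fun ε => exists_tilt ν₀ hm hb hz (hη0 ε) (hη ε)
  have hle := fun ε => tilt_le hm hb (hη0 ε) (hη ε) (hν' ε)
  have hmodel' : ∀ ε, Model κ₁ κ₂ (ν' ε) := fun ε =>
    hmodel.of_le ENNReal.ofReal_ne_top (hle ε).1 (hle ε).2
  set p := (ν₀ : Measure MassPartition) {s | s.1 0 ≤ 3 / 4}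
  have hp0 : p ≠ 0 := by
    have h1 := hdensity.measure_pos le_rfl (by norm_num : (1 / 2 : ℝ) < 3 / 4) (by norm_num)
    exact (h1.trans_le (measure_mono fun s hs => hs.2.le)).ne'
  have hp1 : p ≠ ∞ := measure_ne_top _ _
  -- At size level `ε / 2` the expected count is at most `8 / (ε p)`, and it is multiplied by `η² =
  -- ε`.
  set K : ℝ := 8 / p.toReal
  have hppos : 0 < p.toReal := ENNReal.toReal_pos hp0 hp1
  have hK0 : 0 ≤ K := by positivity
  set δ := ENNReal.ofReal (Real.exp (-(2 * K)) / 4)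
  have hδ : 0 < δ := ENNReal.ofReal_pos.2 (by positivity)
  -- The moments differ by `√ε * cov`, that is, by `2 c √ε` with `c = cov / 2`.
  refine ⟨fun ε hε => Real.rpow_pos_of_pos hε _, ?_, ν', fun ε _ => ⟨hmodel' ε,
    hbinary.of_le (hle ε).1, hdensity.of_le two_pos (hle ε).1 (hle ε).2⟩, cov / 2, by positivity, ?_⟩
  · have : Tendsto (fun ε : ℝ => ε ^ (1 / 2 : ℝ)) (𝓝 0) (𝓝 (0 ^ (1 / 2 : ℝ))) :=
      (Real.continuousAt_rpow_const _ _ (Or.inr (by norm_num))).tendsto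
    rw [Real.zero_rpow (by norm_num)] at this
    exact this.mono_left nhdsWithin_le_nhds
  have hσev : ∀ᶠ ε in 𝓝[>] (0 : ℝ), σ ε ≤ ε / 2 := by
    have ho : (fun ε : ℝ => ε ^ 3) =o[𝓝[>] 0] fun ε : ℝ => ε := by
      have := (Asymptotics.isLittleO_pow_id (𝕜 := ℝ) (n := 3) (by norm_num)).mono
        (nhdsWithin_le_nhds (s := Ioi (0 : ℝ)))
      exact this
    filter_upwards [(hσ_bound.trans_isLittleO ho).bound (by norm_num : (0 : ℝ) < 1 / 2),
      self_mem_nhdsWithin] with ε h1 h2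
    rw [Real.norm_eq_abs, Real.norm_of_nonneg (le_of_lt h2)] at h1
    linarith [le_abs_self (σ ε)]
  -- The larger error probability is at least half of the sum, hence at least `δ / 2`.
  refine (ENNReal.half_pos hδ.ne').trans_le (le_liminf_of_le (by isBoundedDefault) ?_)
  filter_upwards [hσev, Ioo_mem_nhdsGT (by norm_num : (0 : ℝ) < 1 / 4)] with ε hσε hε
  have hsqrt : η ε = √ε := min_eq_left <| by
    rw [Real.sqrt_le_left (by norm_num)]; linarith [hε.2]
  have hx : 0 < ε / 2 := by linarith [hε.1]
  have hcount := mul_tsum_measure_size_le hbinary hx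
  have hcount' : ∑' w, envLaw ν₀ {ω | ε / 2 ≤ size ω w} ≤ ENNReal.ofReal (8 / ε) / p := by
    rw [ENNReal.le_div_iff_mul_le (Or.inl hp0) (Or.inl hp1), mul_comm]
    refine hcount.trans_eq ?_
    congr 1; field_simp; norm_num
  have hKbound : ENNReal.ofReal (η ε ^ 2) * ∑' w, envLaw ν₀ {ω | ε / 2 ≤ size ω w} ≤
      ENNReal.ofReal K := by
    refine (mul_le_mul_right hcount' _).trans_eq ?_
    rw [hsqrt, Real.sq_sqrt hε.1.le, ← mul_div_assoc, ← ENNReal.ofReal_mul hε.1.le,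
      mul_div_cancel₀ _ hε.1.ne', ENNReal.ofReal_div_of_pos hppos, ENNReal.ofReal_toReal hp1]
  have hfinite : ∑' w, envLaw ν₀ {ω | ε / 2 ≤ size ω w} ≠ ∞ :=
    ne_top_of_le_ne_top (ENNReal.div_ne_top ENNReal.ofReal_ne_top hp0) hcount'
  refine le_iInf₂ fun F hF => ?_
  have hsum : δ ≤ _ := errorProb_add_ge (α := α) (k := k) (hσ ε hε.1) hσε hQ
    (fun A₀ A₁ hA₀ hA₁ hcover hst => sum_errors_ge hm hb hz (hη0 ε) (hη ε) (hν' ε) hKbound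
      hfinite hK0 hA₀ hA₁ hcover hst)
    (Real.rpow_pos_of_pos hε.1 (1 / 2)) (c := cov / 2) (by
      rw [moment_withDensity (hfin _ hmodel) (hfin _ (hmodel' ε)) hm hb (hη0 ε) (hη ε) (hν' ε),
        hsqrt, ← Real.sqrt_eq_rpow, add_sub_cancel_left]
      refine le_trans (le_of_eq ?_) (le_abs_self _)
      ring) hF
  rw [ENNReal.div_le_iff_le_mul (by simp) (by simp), mul_two]
  exact hsum.trans (add_le_add (le_max_left _ _) (le_max_right _ _))
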